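/- **Theorem 4.13.** All graphs are finite and simple. For a graph $G$ with at least one vertex, let $q(G)$ denote the largest eigenvalue of $A(G)+D(G)$, where $A(G)$ is the adjacency matrix and $D(G)$ the diagonal degree matrix of $G$. For integers $n\ge k\ge 2s\ge 0$ let $W_{n,k,s}=K_s\vee\big((n-k+s)K_1\cup K_{k-2s}\big)$, i.e. the graph on $n$ vertices whose vertex set is partitioned into $X,Y,Z$ with $|X|=s$, $|Y|=k-2s$, $|Z|=n-k+s$, and whose edges are all pairs inside $X\cup Y$ and all pairs between $X$ and $Z$. A graph is 2-connected if it has at least three vertices, is connected, and remains connected after deletion of any one vertex. (i) Let $n\ge k\ge 5$ and $t=\lfloor (k-1)/2\rfloor$. If $G$ is a 2-connected $n$-vertex graph with $q(G)>\max_{2\le s\le t} q(W_{n,k,s})$, then $G$ has a cycle of length at least $k$. In particular, the maximum of $q(G)$ over all 2-connected $n$-vertex graphs $G$ with no cycle of length at least $k$ exists and equals $\max_{2\le s\le t} q(W_{n,k,s})$. (ii) Let $n\ge k\ge 4$ and $t=\lfloor k/2\rfloor-1$. If $G$ is a connected $n$-vertex graph with $q(G)>\max_{1\le s\le t} q(W_{n,k-1,s})$,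 then $G$ has a path of order $k$ (that is, a path on $k$ vertices). In particular, the maximum of $q(G)$ over all connected $n$-vertex graphs $G$ containing no path of order $k$ exists and equals $\max_{1\le s\le t} q(W_{n,k-1,s})$. -/

import Mathlib

namespace SpectralCycles

/-- The signless Laplacian matrix `D(G) + A(G)` over the reals. -/
noncomputable def signlessLap {V : Type*} [Fintype V] [DecidableEq V] (G : SimpleGraph V)
    [DecidableRel G.Adj] : Matrix V V ℝ :=
  G.degMatrix ℝ + G.adjMatrix ℝ

open Classical in
/-- The signless Laplacian spectral radius `q(G)`: the largest eigenvalue of `A(G) + D(G)`.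
(The set of eigenvalues is finite, and nonempty when the graph has a vertex, so the supremum
is a maximum; see `isGreatest_q`.) -/
noncomputable def q {V : Type*} [Fintype V] (G : SimpleGraph V) : ℝ :=
  sSup {μ : ℝ | Module.End.HasEigenvalue (Matrix.toLin' (signlessLap G)) μ}

open Classical in
/-- On a nonempty vertex set, `q G` really is the largest eigenvalue. -/
theorem isGreatest_q {V : Type*} [Fintype V] [Nonempty V] (G : SimpleGraph V) :
    IsGreatest {μ : ℝ | Module.End.HasEigenvalue (Matrix.toLin' (signlessLap G)) μ} (q G) := by
  have hH : (signlessLap G).IsHermitian := by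
    refine Matrix.IsHermitian.add ?_ ?_
    · exact Matrix.isHermitian_diagonal_of_self_adjoint _ (by ext; simp)
    · ext i j
      simp [SimpleGraph.adjMatrix_apply, SimpleGraph.adj_comm]
  have hset : {μ : ℝ | Module.End.HasEigenvalue (Matrix.toLin' (signlessLap G)) μ}
      = Set.range hH.eigenvalues := by
    rw [← hH.spectrum_real_eq_range_eigenvalues, ← Matrix.spectrum_toLin']
    ext μ
    exact Module.End.hasEigenvalue_iff_mem_spectrum
  have hfin : (Set.range hH.eigenvalues).Finite := Set.finite_range _
  have hne : (Set.range hH.eigenvalues).Nonempty := Set.range_nonempty _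
  unfold q
  rw [hset]
  exact ⟨hne.csSup_mem hfin, fun _ hx => le_csSup hfin.bddAbove hx⟩

/-- The graph `W_{n,k,s} = K_s ∨ ((n-k+s) K_1 ∪ K_{k-2s})` (for `2s ≤ k ≤ n`) on the vertex set
`{0, …, n-1}`, with `X = {i | i < s}`, `Y = {i | s ≤ i < k - s}` and `Z = {i | k - s ≤ i}`:
all edges inside `X ∪ Y` and all edges between `X` and `Z`. -/
def W (n k s : ℕ) : SimpleGraph (Fin n) where
  Adj i j := i ≠ j ∧
    ((i.val < k - s ∧ j.val < k - s) ∨ (i.val < s ∧ k - s ≤ j.val) ∨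
      (j.val < s ∧ k - s ≤ i.val))
  symm := ⟨fun i j h => ⟨h.1.symm, by tauto⟩⟩
  loopless := ⟨fun _ h => h.1 rfl⟩

/-- `G` is 2-connected: at least three vertices, connected, and no cut vertex. -/
def TwoConnected {V : Type*} [Fintype V] (G : SimpleGraph V) : Prop :=
  3 ≤ Fintype.card V ∧ G.Connected ∧ ∀ v : V, (G.induce {v}ᶜ).Connected

/-- `G` has a cycle of length at least `k`. -/
def HasCycleGE {V : Type*} (G : SimpleGraph V) (k : ℕ) : Prop :=
  ∃ (v : V) (c : G.Walk v v), c.IsCycle ∧ k ≤ c.length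

/-- `G` has a path of order `k`, that is, a path with exactly `k` vertices
(a copy of `P_k` in `G`). -/
def HasPathOfOrder {V : Type*} (G : SimpleGraph V) (k : ℕ) : Prop :=
  ∃ (u v : V) (p : G.Walk u v), p.IsPath ∧ p.length + 1 = k

end SpectralCycles

namespace SpectralCycles

/-! The structural half is Kopylov's theorem. By `exists_coreLE`, a 2-connected graph on at least
`k` vertices with no cycle of length at least `k` satisfies, for some `2 ≤ s ≤ t`, the condition
that no set of more than `k - s` vertices spans minimum degree above `s`. The condition passes to
subgraphs, so the graph may be taken edge-maximal without long cycles. Any two nonadjacent vertices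
are then ends of a path on at least `k` vertices. `PathOn.hasCycleGE_of_degIn` closes such a path to
a long cycle once its ends have `k` neighbours on it in total. Hence `adj_of_degIn`: two vertex sets
whose minimum degrees add up to `k` are completely joined. A largest dense set is therefore a
clique, and if all levels `s` failed, it could be enlarged or closed to a long cycle.

The spectral half, `q_le_of_coreLE`, uses only the core condition. The largest eigenvalue is a
Rayleigh quotient at a nonnegative vector `x`, and the quadratic form is the sum of `(x i + x j) ^
2` over edges. Sort `x` decreasingly and lay `W` over it, its dominating vertices at the largest
entries. For each `c` the pairs with `(x i + x j) ^ 2 ≥ c` form a threshold graph, in which `W` has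
at least as many edges as `G` by `pairCount_le`. Comparing the counts for all `c` compares the two
sums (`sum_le_sum_of_card_filter_le`).

The path statement reduces to cycles through the cone: a long cycle of `cone G` gives a path of `G`
with one vertex fewer, and the core condition drops by one in both parameters. The bounds are
attained because in `W` the independent set `Z` has all its neighbours in the small set `X`, so a
cycle or path can visit `Z` only a few times. -/

/-- `PathOn G u v S`: there is a path in `G` from `u` to `v` whose vertex set is `S`. -/
inductive PathOn {V : Type*} [DecidableEq V] (G : SimpleGraph V) : V → V → Finset V → Prop
  | single (v : V) : PathOn G v v {v}
  | cons {u v w : V} {S : Finset V} : G.Adj u v → PathOn G v w S → u ∉ S →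
      PathOn G u w (insert u S)

/-! ### Paths recorded by their ends and vertex set -/

namespace PathOn

variable {V : Type*} [DecidableEq V] {G G' : SimpleGraph V} {u v w z : V} {S T : Finset V}

theorem left_mem (h : PathOn G u v S) : u ∈ S := by
  cases h <;> simp

theorem right_mem (h : PathOn G u v S) : v ∈ S := by
  induction h with
  | single => simp
  | cons _ _ _ ih => exact Finset.mem_insert_of_mem ih

theorem append (h : PathOn G u v S) (hvw : G.Adj v w) (h' : PathOn G w z T)
    (hd : Disjoint S T) : PathOn G u z (S ∪ T) := by
  induction h with
  | single v =>
    rw [← Finset.insert_eq]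
    exact cons hvw h' (by simpa using hd)
  | cons ha _ hn ih =>
    rw [Finset.disjoint_insert_left] at hd
    rw [Finset.insert_union]
    exact cons ha (ih hvw hd.2) (by simp [hn, hd.1])

theorem symm (h : PathOn G u v S) : PathOn G v u S := by
  induction h with
  | single v => exact single v
  | @cons a b c S ha _ hn ih =>
    have := append ih ha.symm (single a) (by simpa using hn)
    rwa [Finset.union_comm, ← Finset.insert_eq] at this

theorem trans (h : PathOn G u v S) (h' : PathOn G v w T) (hd : S ∩ T ⊆ {v}) :
    PathOn G u w (S ∪ T) := by
  induction h with
  | single v =>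
    rwa [← Finset.insert_eq, Finset.insert_eq_of_mem h'.left_mem]
  | @cons a b c S ha hp hn ih =>
    rw [Finset.insert_union]
    refine cons ha (ih h' ?_) ?_
    · exact (Finset.inter_subset_inter_right (Finset.subset_insert _ _)).trans hd
    · intro hmem
      rcases Finset.mem_union.1 hmem with h1 | h1
      · exact hn h1
      · have : a ∈ ({c} : Finset V) := hd (by simp [h1])
        rw [Finset.mem_singleton] at this
        exact hn (this ▸ hp.right_mem)

theorem split (h : PathOn G u v S) (hw : w ∈ S) :
    ∃ S₁ S₂, PathOn G u w S₁ ∧ PathOn G w v S₂ ∧ S₁ ∪ S₂ = S ∧ S₁ ∩ S₂ = {w} := by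
  induction h with
  | single v =>
    obtain rfl : w = v := by simpa using hw
    exact ⟨{w}, {w}, single w, single w, by simp, by simp⟩
  | @cons a b c S ha hp hn ih =>
    by_cases hwa : w = a
    · subst hwa
      exact ⟨{w}, insert w S, single w, cons ha hp hn, by simp,
        Finset.inter_eq_left.2 (by simp)⟩
    · obtain ⟨S₁, S₂, h1, h2, h3, h4⟩ := ih (by simpa [hwa] using hw)
      have ha1 : a ∉ S₁ := fun h => hn (h3 ▸ Finset.mem_union_left _ h)
      have ha2 : a ∉ S₂ := fun h => hn (h3 ▸ Finset.mem_union_right _ h)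
      exact ⟨insert a S₁, S₂, cons ha h1 ha1, h2, by rw [Finset.insert_union, h3],
        by rw [Finset.insert_inter_of_notMem ha2, h4]⟩

theorem mono (h : PathOn G u v S) (hle : ∀ a ∈ S, ∀ b ∈ S, G.Adj a b → G'.Adj a b) :
    PathOn G' u v S := by
  induction h with
  | single v => exact single v
  | @cons a b c S ha hp hn ih =>
    refine cons (hle _ (by simp) _ (by simp [hp.left_mem]) ha) (ih fun x hx y hy => ?_) hn
    exact hle _ (Finset.mem_insert_of_mem hx) _ (Finset.mem_insert_of_mem hy)

theorem map {V' : Type*} [DecidableEq V'] {H : SimpleGraph V'} (f : V ↪ V')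
    (hf : ∀ a b, G.Adj a b → H.Adj (f a) (f b)) (h : PathOn G u v S) :
    PathOn H (f u) (f v) (S.map f) := by
  induction h with
  | single v => simpa using single (G := H) (f v)
  | @cons a b c S ha hp hn ih =>
    rw [Finset.map_insert]
    exact cons (hf _ _ ha) ih (by simpa using hn)

theorem of_isPath {p : G.Walk u v} (hp : p.IsPath) : PathOn G u v p.support.toFinset := by
  induction p with
  | nil => simpa using single _
  | cons ha p ih =>
    rw [SimpleGraph.Walk.cons_isPath_iff] at hp
    rw [SimpleGraph.Walk.support_cons, List.toFinset_cons]
    exact cons ha (ih hp.1) (by simpa using hp.2)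

theorem exists_isPath (h : PathOn G u v S) :
    ∃ p : G.Walk u v, p.IsPath ∧ p.support.toFinset = S := by
  induction h with
  | single v => exact ⟨.nil, by simp, by simp⟩
  | @cons a b c S ha hp hn ih =>
    obtain ⟨p, hp1, hp2⟩ := ih
    refine ⟨.cons ha p, ?_, by simp [hp2]⟩
    rw [SimpleGraph.Walk.cons_isPath_iff]
    refine ⟨hp1, fun h => hn ?_⟩
    rw [← hp2]
    simpa using h

theorem _root_.SimpleGraph.Walk.IsPath.card_support_toFinset {p : G.Walk u v} (hp : p.IsPath) :
    p.support.toFinset.card = p.length + 1 := by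
  rw [List.toFinset_card_of_nodup hp.support_nodup, SimpleGraph.Walk.length_support]

theorem eq_singleton (h : PathOn G u u S) : S = {u} := by
  cases h with
  | single => rfl
  | cons _ hp hn => exact absurd hp.right_mem hn

/-- Closing a path by an edge between its ends gives a cycle. -/
theorem hasCycleGE (h : PathOn G u v S) (hvu : G.Adj v u) {k : ℕ} (h3 : 3 ≤ S.card)
    (hk : k ≤ S.card) : HasCycleGE G k := by
  obtain ⟨p, hp, rfl⟩ := h.exists_isPath
  rw [hp.card_support_toFinset] at h3 hk
  refine ⟨v, .cons hvu p, ?_, by simpa using hk⟩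
  rw [SimpleGraph.Walk.cons_isCycle_iff]
  refine ⟨hp, fun he => ?_⟩
  have hl := hp.length_eq_one_of_mem_edges (by rwa [Sym2.eq_swap] at he)
  omega

/-- Opening a cycle at any of its vertices. -/
theorem of_isCycle {c : G.Walk v v} (hc : c.IsCycle) (hu : u ∈ c.support) :
    ∃ w, PathOn G w u c.support.toFinset ∧ G.Adj u w ∧
      c.support.toFinset.card = c.length := by
  have key : ∀ {v : V} (c : G.Walk v v), c.IsCycle → ∃ w, PathOn G w v c.support.toFinset ∧
      G.Adj v w ∧ c.support.toFinset.card = c.length := by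
    intro v c hc
    cases c with
    | nil => simp at hc
    | @cons _ b _ ha p =>
      rw [SimpleGraph.Walk.cons_isCycle_iff] at hc
      have hs : (SimpleGraph.Walk.cons ha p).support.toFinset = p.support.toFinset := by
        ext x
        simp only [SimpleGraph.Walk.support_cons, List.toFinset_cons, Finset.mem_insert,
          List.mem_toFinset, or_iff_right_iff_imp]
        rintro rfl
        exact p.end_mem_support
      refine ⟨b, ?_, ha, ?_⟩
      · rw [hs]; exact of_isPath hc.1
      · rw [hs, hc.1.card_support_toFinset, SimpleGraph.Walk.length_cons]
  obtain ⟨w, h1, h2, h3⟩ := key _ (hc.rotate hu)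
  have hs : (c.rotate u hu).support.toFinset = c.support.toFinset := by
    ext x; simp [SimpleGraph.Walk.mem_support_rotate_iff]
  rw [hs] at h1 h3
  refine ⟨w, h1, h2, ?_⟩
  rw [h3]; simp

/-- The vertices of a path, listed in order. -/
theorem exists_index (h : PathOn G u v S) :
    ∃ (m : ℕ) (p : ℕ → V), p 0 = u ∧ p m = v ∧ S = (Finset.range (m + 1)).image p ∧
      Set.InjOn p (Set.Iic m) ∧ ∀ i < m, G.Adj (p i) (p (i + 1)) := by
  obtain ⟨p, hp, rfl⟩ := h.exists_isPath
  refine ⟨p.length, p.getVert, by simp, by simp, ?_, ?_, ?_⟩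
  · ext x
    simp only [List.mem_toFinset, SimpleGraph.Walk.mem_support_iff_exists_getVert,
      Finset.mem_image, Finset.mem_range, Nat.lt_succ_iff]
    tauto
  · exact hp.getVert_injOn
  · intro i hi; exact p.adj_getVert_succ hi

/-- A segment of an indexed path. -/
theorem of_index {m : ℕ} {p : ℕ → V} (hinj : Set.InjOn p (Set.Iic m))
    (hadj : ∀ i < m, G.Adj (p i) (p (i + 1))) {i j : ℕ} (hij : i ≤ j) (hj : j ≤ m) :
    PathOn G (p i) (p j) ((Finset.Icc i j).image p) := by
  induction j, hij using Nat.le_induction with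
  | base => simpa using single (p i)
  | succ j hij ih =>
    have := append (ih (by omega)) (hadj j (by omega)) (single (p (j + 1))) (by
      rw [Finset.disjoint_singleton_right]
      intro hm
      obtain ⟨l, hl, hl'⟩ := Finset.mem_image.1 hm
      rw [Finset.mem_Icc] at hl
      have := hinj (by simp; omega) (by simp; omega) hl'
      omega)
    rwa [← Finset.image_singleton, ← Finset.image_union, show
      Finset.Icc i j ∪ {j + 1} = Finset.Icc i (j + 1) by ext; simp; omega] at this

end PathOn
end SpectralCycles

/-! ### Kopylov's lemma: closing a long path to a long cycle -/

namespace SpectralCycles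

open Classical in
/-- The number of neighbours of `v` in `T`. -/
noncomputable def degIn {V : Type*} (G : SimpleGraph V) (T : Finset V) (v : V) : ℕ :=
  (T.filter (G.Adj v)).card

variable {V : Type*} [DecidableEq V] {G : SimpleGraph V}

theorem PathOn.hasCycleGE_of_two {u v : V} {S T : Finset V} (h : PathOn G u v S)
    (h' : PathOn G u v T) (huv : u ≠ v) (hd : S ∩ T ⊆ {u, v}) {k : ℕ}
    (h3 : 3 ≤ (S ∪ T).card) (hk : k ≤ (S ∪ T).card) : HasCycleGE G k := by
  cases h' with
  | single => exact absurd rfl huv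
  | @cons _ w _ T' ha hp hn =>
    have hU : S ∪ insert u T' = S ∪ T' := by
      rw [Finset.union_insert, ← Finset.insert_union, Finset.insert_eq_of_mem h.left_mem]
    rw [hU] at h3 hk
    refine (h.trans hp.symm ?_).hasCycleGE ha.symm h3 hk
    intro x hx
    rw [Finset.mem_inter] at hx
    have := hd (Finset.mem_inter.2 ⟨hx.1, Finset.mem_insert_of_mem hx.2⟩)
    rw [Finset.mem_insert] at this
    rcases this with rfl | h1
    · exact absurd hx.2 hn
    · exact h1

/-- In a graph that stays connected after deletion of `c`, two sets missing `c` are joined by a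
path which avoids `c` and meets each of them only in an end. -/
theorem exists_pathOn_between {c : V} (hc : (G.induce {c}ᶜ).Connected) {A B : Finset V}
    (hA : A.Nonempty) (hB : B.Nonempty) (hcA : c ∉ A) (hcB : c ∉ B) :
    ∃ a ∈ A, ∃ b ∈ B, ∃ S, PathOn G a b S ∧ c ∉ S ∧ S ∩ A ⊆ {a} ∧ S ∩ B ⊆ {b} := by
  classical
  have hex : ∃ n, ∃ a ∈ A, ∃ b ∈ B, ∃ S, PathOn G a b S ∧ c ∉ S ∧ S.card = n := by
    obtain ⟨a, ha⟩ := hA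
    obtain ⟨b, hb⟩ := hB
    have hac : a ∈ ({c}ᶜ : Set V) := by rintro rfl; exact hcA ha
    have hbc : b ∈ ({c}ᶜ : Set V) := by rintro rfl; exact hcB hb
    obtain ⟨p, hp⟩ := (hc.preconnected ⟨a, hac⟩ ⟨b, hbc⟩).exists_isPath
    refine ⟨_, a, ha, b, hb, _, (PathOn.of_isPath hp).map (Function.Embedding.subtype _)
      (fun x y hxy => hxy), ?_, rfl⟩
    intro hm
    obtain ⟨x, -, hx⟩ := Finset.mem_map.1 hm
    exact x.2 hx
  -- Take a shortest path: meeting `A` or `B` away from its end would let it be cut shorter.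
  obtain ⟨a, ha, b, hb, S, hS, hcS, hcard⟩ := Nat.find_spec hex
  have hmin : ∀ a ∈ A, ∀ b ∈ B, ∀ T, PathOn G a b T → c ∉ T → S.card ≤ T.card :=
    fun a ha b hb T hT hcT => hcard ▸ Nat.find_min' hex ⟨a, ha, b, hb, T, hT, hcT, rfl⟩
  refine ⟨a, ha, b, hb, S, hS, hcS, ?_, ?_⟩
  · intro x hx
    rw [Finset.mem_inter] at hx
    obtain ⟨S₁, S₂, h1, h2, h3, h4⟩ := hS.split hx.1
    have hsub : S₂ ⊆ S := h3 ▸ Finset.subset_union_right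
    have heq := Finset.eq_of_subset_of_card_le hsub (hmin x hx.2 b hb S₂ h2 fun h => hcS (hsub h))
    have : a ∈ S₁ ∩ S₂ := Finset.mem_inter.2 ⟨h1.left_mem, heq ▸ hS.left_mem⟩
    rw [h4, Finset.mem_singleton] at this
    simp [this]
  · intro x hx
    rw [Finset.mem_inter] at hx
    obtain ⟨S₁, S₂, h1, h2, h3, h4⟩ := hS.split hx.1
    have hsub : S₁ ⊆ S := h3 ▸ Finset.subset_union_left
    have heq := Finset.eq_of_subset_of_card_le hsub (hmin a ha x hx.2 S₁ h1 fun h => hcS (hsub h))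
    have : b ∈ S₁ ∩ S₂ := Finset.mem_inter.2 ⟨heq ▸ hS.right_mem, h2.right_mem⟩
    rw [h4, Finset.mem_singleton] at this
    simp [this]

section Index

variable {m : ℕ} {p : ℕ → V}

/-- Crossing neighbours of the two ends of a path close it to a long cycle. -/
theorem hasCycleGE_of_crossing (hinj : Set.InjOn p (Set.Iic m))
    (hadj : ∀ i < m, G.Adj (p i) (p (i + 1))) {k : ℕ} (hk3 : 3 ≤ k) (hkm : k ≤ m + 1)
    {X Y : Finset ℕ} (hX : ∀ l, l ∈ X ↔ l ≤ m ∧ G.Adj (p 0) (p l))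
    (hY : ∀ l, l ∈ Y ↔ l ≤ m ∧ G.Adj (p m) (p l)) (hXY : k ≤ X.card + Y.card)
    (hcross : ∃ i ∈ Y, ∃ j ∈ X, i < j) : HasCycleGE G k := by
  classical
  have hex : ∃ d, ∃ i ∈ Y, ∃ j ∈ X, j = i + 1 + d := by
    obtain ⟨i, hi, j, hj, hij⟩ := hcross
    exact ⟨j - i - 1, i, hi, j, hj, by omega⟩
  -- With the gap `j - i` minimal, no index strictly between `i` and `j` lies in `X` or `Y`. The
  -- cycle runs from `p 0` to `p i`, jumps to `p m`, goes back to `p j` and closes at `p 0`.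
  obtain ⟨i, hi, j, hj, hd⟩ := Nat.find_spec hex
  have hmin : ∀ i' ∈ Y, ∀ j' ∈ X, i' < j' → j - i ≤ j' - i' := by
    intro i' hi' j' hj' h
    have := Nat.find_min' hex (m := j' - i' - 1) ⟨i', hi', j', hj', by omega⟩
    omega
  have hij : i < j := by omega
  clear hd
  have hi2 := (hY i).1 hi
  have hj2 := (hX j).1 hj
  have hp1 : PathOn G (p 0) (p i) _ := PathOn.of_index hinj hadj (Nat.zero_le i) hi2.1
  have hp2 : PathOn G (p j) (p m) _ := PathOn.of_index hinj hadj hj2.1 le_rfl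
  have hdis : Disjoint ((Finset.Icc 0 i).image p) ((Finset.Icc j m).image p) := by
    rw [Finset.disjoint_left]
    intro x hx hx'
    obtain ⟨l, hl, rfl⟩ := Finset.mem_image.1 hx
    obtain ⟨l', hl', he⟩ := Finset.mem_image.1 hx'
    rw [Finset.mem_Icc] at hl hl'
    have := hinj (by simp; omega) (by simp; omega) he
    omega
  have hc := hp1.append hi2.2.symm hp2.symm hdis
  have hcard : k ≤ ((Finset.Icc 0 i).image p ∪ (Finset.Icc j m).image p).card := by
    rw [← Finset.image_union, Finset.card_image_of_injOn (hinj.mono (by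
      intro l hl; simp at hl ⊢; omega))]
    by_cases h1 : j = i + 1
    · have : Finset.Icc 0 i ∪ Finset.Icc j m = Finset.range (m + 1) := by ext; simp; omega
      rw [this, Finset.card_range]; exact hkm
    -- When the minimal gap exceeds one, no `l ∈ Y` has `l + 1 ∈ X`. So `X` without `j`, shifted
    -- down by one, is disjoint from `Y ∪ {m}`; both sets avoid the gap and together they have `|X|
    -- + |Y|` elements.
    · have hsub : ((X.erase j).image (fun l => l - 1)) ∪ insert m Y ⊆
          Finset.Icc 0 i ∪ Finset.Icc j m := by
        intro l hl
        simp only [Finset.mem_union, Finset.mem_image, Finset.mem_erase, Finset.mem_insert,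
          Finset.mem_Icc] at hl ⊢
        rcases hl with ⟨l', ⟨hne, hl'⟩, rfl⟩ | rfl | hl
        · by_contra hcon
          have := hmin i hi l' hl' (by omega)
          have := (hX l').1 hl'
          omega
        · omega
        · by_contra hcon
          have := (hY l).1 hl
          have := hmin l hl j hj (by omega)
          omega
      have hpos : ∀ l ∈ X, 1 ≤ l := by
        intro l hl
        rcases Nat.eq_zero_or_pos l with rfl | h
        · exact absurd ((hX 0).1 hl).2 (G.loopless.irrefl _)
        · exact h
      have hdisj : Disjoint ((X.erase j).image (fun l => l - 1)) (insert m Y) := by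
        rw [Finset.disjoint_left]
        intro l hl hl'
        simp only [Finset.mem_image, Finset.mem_erase, Finset.mem_insert] at hl hl'
        obtain ⟨l₁, ⟨hne, hl₁⟩, rfl⟩ := hl
        have h0 := hpos _ hl₁
        have h2 := ((hX _).1 hl₁).1
        rcases hl' with h | h
        · omega
        · have := hmin _ h _ hl₁ (by omega)
          omega
      have hmY : m ∉ Y := fun h => G.loopless.irrefl _ ((hY m).1 h).2
      have := Finset.card_le_card hsub
      rw [Finset.card_union_of_disjoint hdisj, Finset.card_insert_of_notMem hmY,
        Finset.card_image_of_injOn, Finset.card_erase_of_mem hj] at this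
      · omega
      · intro a ha b hb hab
        have h1 := hpos a (Finset.mem_of_mem_erase ha)
        have h2 := hpos b (Finset.mem_of_mem_erase hb)
        simp only at hab
        omega
  exact hc.hasCycleGE hj2.2.symm (hk3.trans hcard) hcard

/-- `Linked G p m a c`: two disjoint paths run from `p a` and an earlier `p a₁` to `p c` and a
later `p c₁`, otherwise avoiding all `p l` with `l < a` or `c < l`. -/
def Linked (G : SimpleGraph V) (p : ℕ → V) (m a c : ℕ) : Prop :=
  ∃ a₁ c₁ f f' R R', a₁ < a ∧ c < c₁ ∧ c₁ ≤ m ∧ ((f = a ∧ f' = a₁) ∨ (f = a₁ ∧ f' = a)) ∧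
    PathOn G (p f) (p c) R ∧ PathOn G (p f') (p c₁) R' ∧ Disjoint R R' ∧
    (∀ l < a, p l ∈ R ∪ R' → l = a₁) ∧ (∀ l, c < l → l ≤ m → p l ∈ R ∪ R' → l = c₁)

/-- One path is the single vertex `p a`; the other is a detour around it, which exists because `p a`
is not a cut vertex. -/
theorem linked_self (hinj : Set.InjOn p (Set.Iic m)) (hG : ∀ v, (G.induce {v}ᶜ).Connected)
    {a : ℕ} (ha : 0 < a) (ham : a < m) : Linked G p m a a := by
  obtain ⟨x, hx, y, hy, Q, hQ, hcQ, h1, h2⟩ := exists_pathOn_between (hG (p a))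
    (A := (Finset.range a).image p) (B := (Finset.Icc (a + 1) m).image p)
    ⟨p 0, Finset.mem_image_of_mem _ (by simpa)⟩
    ⟨p m, Finset.mem_image_of_mem _ (by simp; omega)⟩
    (by
      intro h
      obtain ⟨l, hl, he⟩ := Finset.mem_image.1 h
      rw [Finset.mem_range] at hl
      have := hinj (by simp; omega) (by simp; omega) he
      omega)
    (by
      intro h
      obtain ⟨l, hl, he⟩ := Finset.mem_image.1 h
      rw [Finset.mem_Icc] at hl
      have := hinj (by simp; omega) (by simp; omega) he
      omega)
  obtain ⟨a₁, ha₁, rfl⟩ := Finset.mem_image.1 hx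
  obtain ⟨c₁, hc₁, rfl⟩ := Finset.mem_image.1 hy
  rw [Finset.mem_range] at ha₁
  rw [Finset.mem_Icc] at hc₁
  refine ⟨a₁, c₁, a, a₁, {p a}, Q, ha₁, by omega, hc₁.2, Or.inl ⟨rfl, rfl⟩, .single _, hQ,
    by simpa using hcQ, ?_, ?_⟩
  · intro l hl hm
    rw [Finset.mem_union, Finset.mem_singleton] at hm
    rcases hm with hm | hm
    · have := hinj (by simp; omega) (by simp; omega) hm
      omega
    · have := h1 (Finset.mem_inter.2 ⟨hm, Finset.mem_image_of_mem _ (by simpa using hl)⟩)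
      exact hinj (by simp; omega) (by simp; omega) (Finset.mem_singleton.1 this)
  · intro l hl hlm hm
    rw [Finset.mem_union, Finset.mem_singleton] at hm
    rcases hm with hm | hm
    · have := hinj (by simp; omega) (by simp; omega) hm
      omega
    · have := h2 (Finset.mem_inter.2 ⟨hm, Finset.mem_image_of_mem _ (by simp; omega)⟩)
      exact hinj (by simp; omega) (by simp; omega) (Finset.mem_singleton.1 this)

/-- If the second path does not already end at `p (c + 1)`, the first is extended by one edge.
Otherwise a detour `Q` around `p (c + 1)` leaves the part already used and reaches a later vertex.
Three cases arise: `Q` leaves from `R`, from `R'`, or from an initial vertex on neither. -/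
theorem Linked.succ (hinj : Set.InjOn p (Set.Iic m)) (hadj : ∀ i < m, G.Adj (p i) (p (i + 1)))
    (hG : ∀ v, (G.induce {v}ᶜ).Connected) {a c : ℕ} (hac : a ≤ c) (hcm : c + 1 < m)
    (h : Linked G p m a c) : Linked G p m a (c + 1) := by
  obtain ⟨a₁, c₁, f, f', R, R', ha₁, hcc₁, hc₁, hf, hR, hR', hd, hlo, hhi⟩ := h
  have hne : ∀ {i j}, i ≤ m → j ≤ m → p i = p j → i = j :=
    fun hi hj he => hinj hi hj he
  have hext : p (c + 1) ∉ R → PathOn G (p f) (p (c + 1)) (R ∪ {p (c + 1)}) := fun hn =>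
    hR.append (hadj c (by omega)) (.single _) (by simpa using hn)
  by_cases hc : c₁ = c + 1
  swap
  · have hn : p (c + 1) ∉ R ∪ R' := fun h => hc (hhi _ (by omega) (by omega) h).symm
    rw [Finset.mem_union, not_or] at hn
    refine ⟨a₁, c₁, f, f', R ∪ {p (c + 1)}, R', ha₁, by omega, hc₁, hf, hext hn.1, hR', ?_, ?_, ?_⟩
    · rw [Finset.disjoint_union_left]
      exact ⟨hd, by simpa using hn.2⟩
    · intro l hl hm
      by_cases hl' : p l = p (c + 1)
      · have := hne (by omega) (by omega) hl'
        omega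
      · exact hlo l hl (by simpa [hl'] using hm)
    · intro l hl hlm hm
      by_cases hl' : p l = p (c + 1)
      · have := hne (by omega) (by omega) hl'
        omega
      · exact hhi l (by omega) hlm (by simpa [hl'] using hm)
  subst hc
  have hcR : p (c + 1) ∉ R := fun h => Finset.disjoint_left.1 hd h hR'.right_mem
  obtain ⟨x, hx, y, hy, Q, hQ, hcQ, h1, h2⟩ := exists_pathOn_between (hG (p (c + 1)))
    (A := ((Finset.range a).image p ∪ (R ∪ R')).erase (p (c + 1)))
    (B := (Finset.Icc (c + 2) m).image p)
    ⟨p c, by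
      rw [Finset.mem_erase, Finset.mem_union, Finset.mem_union]
      refine ⟨fun he => ?_, Or.inr (Or.inl hR.right_mem)⟩
      have := hne (by omega) (by omega) he
      omega⟩
    ⟨p m, Finset.mem_image_of_mem _ (by simp; omega)⟩ (by simp)
    (by
      intro h
      obtain ⟨l, hl, he⟩ := Finset.mem_image.1 h
      rw [Finset.mem_Icc] at hl
      have := hne (by omega) (by omega) he
      omega)
  obtain ⟨c₂, hc₂, rfl⟩ := Finset.mem_image.1 hy
  rw [Finset.mem_Icc] at hc₂
  have hQA : ∀ z ∈ Q, (z ∈ (Finset.range a).image p ∨ z ∈ R ∨ z ∈ R') → z = x := by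
    intro z hz hz'
    refine Finset.mem_singleton.1 (h1 (Finset.mem_inter.2 ⟨hz, ?_⟩))
    rw [Finset.mem_erase, Finset.mem_union, Finset.mem_union]
    exact ⟨fun h => hcQ (h ▸ hz), hz'⟩
  have hQlo : ∀ l < a, p l ∈ Q → p l = x := fun l hl hm =>
    hQA _ hm (Or.inl (Finset.mem_image_of_mem _ (by simpa using hl)))
  have hQhi : ∀ l, c + 1 < l → l ≤ m → p l ∈ Q → l = c₂ := by
    intro l hl hlm hm
    have := h2 (Finset.mem_inter.2 ⟨hm, Finset.mem_image_of_mem _ (by simp; omega)⟩)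
    exact hne (by omega) (by omega) (Finset.mem_singleton.1 this)
  have hRhi : ∀ l, c + 1 < l → l ≤ m → p l ∉ R ∪ R' := by
    intro l hl hlm hm
    have := hhi l (by omega) hlm hm
    omega
  rw [Finset.mem_erase, Finset.mem_union, Finset.mem_union] at hx
  by_cases hxR : x ∈ R
  · obtain ⟨S₁, S₂, hS₁, -, hu, -⟩ := hR.split hxR
    have hsub : S₁ ⊆ R := hu ▸ Finset.subset_union_left
    have hn := hS₁.trans hQ (by
      intro z hz
      rw [Finset.mem_inter] at hz
      exact Finset.mem_singleton.2 (hQA z hz.2 (Or.inr (Or.inl (hsub hz.1)))))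
    -- The paths exchange roles: `R'` already ends at `p (c + 1)`, and `R` is rerouted along `Q`.
    refine ⟨a₁, c₂, f', f, R', S₁ ∪ Q, ha₁, by omega, hc₂.2, by tauto, hR', hn, ?_, ?_, ?_⟩
    · rw [Finset.disjoint_union_right]
      refine ⟨(hd.mono_left hsub).symm, Finset.disjoint_left.2 fun z hz hzQ => ?_⟩
      have := hQA z hzQ (Or.inr (Or.inr hz))
      subst this
      exact Finset.disjoint_left.1 hd hxR hz
    · intro l hl hm
      refine hlo l hl ?_
      rw [Finset.mem_union, Finset.mem_union] at hm
      rw [Finset.mem_union]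
      rcases hm with hm | hm | hm
      · exact Or.inr hm
      · exact Or.inl (hsub hm)
      · exact Or.inl (hQlo l hl hm ▸ hxR)
    · intro l hl hlm hm
      have := hRhi l hl hlm
      rw [Finset.mem_union, not_or] at this
      rw [Finset.mem_union, Finset.mem_union] at hm
      rcases hm with hm | hm | hm
      · exact absurd hm this.2
      · exact absurd (hsub hm) this.1
      · exact hQhi l hl hlm hm
  by_cases hxR' : x ∈ R'
  · obtain ⟨S₁, S₂, hS₁, hS₂, hu, hi⟩ := hR'.split hxR'
    have hsub : S₁ ⊆ R' := hu ▸ Finset.subset_union_left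
    have hcS₁ : p (c + 1) ∉ S₁ := by
      intro h
      have : p (c + 1) ∈ S₁ ∩ S₂ := Finset.mem_inter.2 ⟨h, hS₂.right_mem⟩
      rw [hi, Finset.mem_singleton] at this
      exact hx.1 this.symm
    have hn := hS₁.trans hQ (by
      intro z hz
      rw [Finset.mem_inter] at hz
      exact Finset.mem_singleton.2 (hQA z hz.2 (Or.inr (Or.inr (hsub hz.1)))))
    refine ⟨a₁, c₂, f, f', R ∪ {p (c + 1)}, S₁ ∪ Q, ha₁, by omega, hc₂.2, hf, hext hcR, hn,
      ?_, ?_, ?_⟩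
    · rw [Finset.disjoint_union_right, Finset.disjoint_union_left, Finset.disjoint_union_left]
      refine ⟨⟨hd.mono_right hsub, by simpa using hcS₁⟩,
        Finset.disjoint_left.2 fun z hz hzQ => ?_, by simpa using hcQ⟩
      have := hQA z hzQ (Or.inr (Or.inl hz))
      subst this
      exact hxR hz
    · intro l hl hm
      refine hlo l hl ?_
      rw [Finset.mem_union, Finset.mem_union, Finset.mem_union, Finset.mem_singleton] at hm
      rw [Finset.mem_union]
      rcases hm with (hm | hm) | hm | hm
      · exact Or.inl hm
      · have := hne (by omega) (by omega) hm
        omega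
      · exact Or.inr (hsub hm)
      · exact Or.inr (hQlo l hl hm ▸ hxR')
    · intro l hl hlm hm
      have := hRhi l hl hlm
      rw [Finset.mem_union, not_or] at this
      rw [Finset.mem_union, Finset.mem_union, Finset.mem_union, Finset.mem_singleton] at hm
      rcases hm with (hm | hm) | hm | hm
      · exact absurd hm this.1
      · have := hne (by omega) (by omega) hm
        omega
      · exact absurd (hsub hm) this.2
      · exact hQhi l hl hlm hm
  have hx2 : x ∈ (Finset.range a).image p := by tauto
  obtain ⟨a₂, ha₂, rfl⟩ := Finset.mem_image.1 hx2
  rw [Finset.mem_range] at ha₂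
  -- `Q` with its new start `p a₂` serves as one of the two paths, so only the path starting at `p
  -- a` is kept and `p a₁` is abandoned.
  obtain ⟨E, hE, hEsub, hE₁⟩ : ∃ E, PathOn G (p a) (p (c + 1)) E ∧ E ⊆ R ∪ R' ∧ p a₁ ∉ E := by
    rcases hf with ⟨rfl, rfl⟩ | ⟨rfl, rfl⟩
    · refine ⟨_, hext hcR, ?_, ?_⟩
      · refine Finset.union_subset_union_right ?_
        simpa using hR'.right_mem
      · rw [Finset.mem_union, Finset.mem_singleton, not_or]
        refine ⟨fun h => Finset.disjoint_left.1 hd h hR'.left_mem, fun h => ?_⟩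
        have := hne (by omega) (by omega) h
        omega
    · exact ⟨R', hR', Finset.subset_union_right,
        fun h => Finset.disjoint_left.1 hd hR.left_mem h⟩
  refine ⟨a₂, c₂, a, a₂, E, Q, ha₂, by omega, hc₂.2, Or.inl ⟨rfl, rfl⟩, hE, hQ, ?_, ?_, ?_⟩
  · refine Finset.disjoint_left.2 fun z hz hzQ => ?_
    have hz' := Finset.mem_union.1 (hEsub hz)
    have := hQA z hzQ (Or.inr hz')
    subst this
    tauto
  · intro l hl hm
    rcases Finset.mem_union.1 hm with hm | hm
    · have := hlo l hl (hEsub hm)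
      subst this
      exact absurd hm hE₁
    · exact hne (by omega) (by omega) (hQlo l hl hm)
  · intro l hl hlm hm
    rcases Finset.mem_union.1 hm with hm | hm
    · exact absurd (hEsub hm) (hRhi l hl hlm)
    · exact hQhi l hl hlm hm

theorem linked (hinj : Set.InjOn p (Set.Iic m)) (hadj : ∀ i < m, G.Adj (p i) (p (i + 1)))
    (hG : ∀ v, (G.induce {v}ᶜ).Connected) {a b : ℕ} (ha : 0 < a) (hab : a ≤ b) (hbm : b < m) :
    Linked G p m a b := by
  induction b, hab using Nat.le_induction with
  | base => exact linked_self hinj hG ha hbm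
  | succ c hac ih => exact Linked.succ hinj hadj hG hac hbm (ih (by omega))

/-- A path through `p a₁` and `p a`, inside the first `a + 1` vertices, catching all neighbours
of `p 0`. -/
theorem exists_pathOn_initial (hinj : Set.InjOn p (Set.Iic m))
    (hadj : ∀ i < m, G.Adj (p i) (p (i + 1))) {a a₁ : ℕ} (ha : a₁ < a) (ham : a ≤ m)
    (h0 : G.Adj (p 0) (p a)) :
    ∃ I : Finset ℕ, PathOn G (p a₁) (p a) (I.image p) ∧ I ⊆ Finset.Icc 0 a ∧ 0 ∈ I ∧
      ∀ l ≤ a, G.Adj (p 0) (p l) → l ∈ I := by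
  classical
  -- Let `j` be the first neighbour of `p 0` after `a₁`. The path goes from `p a₁` back to `p 0`,
  -- jumps to `p j` and continues to `p a`; the skipped stretch contains no neighbour of `p 0`.
  have hex : ∃ j, a₁ < j ∧ j ≤ a ∧ G.Adj (p 0) (p j) := ⟨a, ha, le_rfl, h0⟩
  obtain ⟨hj1, hj2, hj3⟩ := Nat.find_spec hex
  have hmin : ∀ l, a₁ < l → l ≤ a → G.Adj (p 0) (p l) → Nat.find hex ≤ l :=
    fun l h1 h2 h3 => Nat.find_min' hex ⟨h1, h2, h3⟩
  generalize Nat.find hex = j at *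
  refine ⟨Finset.Icc 0 a₁ ∪ Finset.Icc j a, ?_, ?_, by simp, ?_⟩
  · rw [Finset.image_union]
    refine (PathOn.of_index hinj hadj (Nat.zero_le _) (by omega)).symm.append hj3
      (PathOn.of_index hinj hadj hj2 ham) ?_
    rw [Finset.disjoint_left]
    intro x hx hx'
    obtain ⟨l, hl, rfl⟩ := Finset.mem_image.1 hx
    obtain ⟨l', hl', he⟩ := Finset.mem_image.1 hx'
    rw [Finset.mem_Icc] at hl hl'
    have := hinj (by simp; omega) (by simp; omega) he
    omega
  · intro l; simp only [Finset.mem_union, Finset.mem_Icc]; omega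
  · intro l hl hla
    simp only [Finset.mem_union, Finset.mem_Icc]
    by_contra hcon
    have := hmin l (by omega) hl hla
    omega

/-- The mirror image of `exists_pathOn_initial`, obtained by reversing the indices. -/
theorem exists_pathOn_final (hinj : Set.InjOn p (Set.Iic m))
    (hadj : ∀ i < m, G.Adj (p i) (p (i + 1))) {b b₁ : ℕ} (hb : b < b₁) (hbm : b₁ ≤ m)
    (h0 : G.Adj (p m) (p b)) :
    ∃ I : Finset ℕ, PathOn G (p b) (p b₁) (I.image p) ∧ I ⊆ Finset.Icc b m ∧ m ∈ I ∧
      ∀ l, b ≤ l → l ≤ m → G.Adj (p m) (p l) → l ∈ I := by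
  obtain ⟨I, h1, h2, h3, h4⟩ := exists_pathOn_initial (G := G) (p := fun l => p (m - l)) (m := m)
    (a := m - b) (a₁ := m - b₁) (fun i hi j hj h => by
      have := hinj (by simp) (by simp) h
      simp at hi hj; omega)
    (fun i hi => by
      have := hadj (m - (i + 1)) (by omega)
      rw [show m - (i + 1) + 1 = m - i by omega] at this
      exact this.symm) (by omega) (by omega)
    (by simpa [show m - (m - b) = b by omega] using h0)
  simp only [show m - (m - b) = b by omega, show m - (m - b₁) = b₁ by omega, Nat.sub_zero] at h1 h4
  refine ⟨I.image (fun l => m - l), ?_, ?_, ?_, ?_⟩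
  · rw [Finset.image_image]; exact h1.symm
  · intro l hl
    obtain ⟨l', hl', rfl⟩ := Finset.mem_image.1 hl
    have := h2 hl'
    rw [Finset.mem_Icc] at this ⊢
    omega
  · exact Finset.mem_image.2 ⟨0, h3, by simp⟩
  · intro l hbl hlm hl
    refine Finset.mem_image.2 ⟨m - l, h4 _ (by omega) ?_, by omega⟩
    rwa [show m - (m - l) = l by omega]

/-- Every neighbour of `p 0` precedes or equals every neighbour of `p m`. An initial path through
all neighbours of `p 0` and a final path through all neighbours of `p m` are joined into a cycle by
the two disjoint paths of `Linked`. -/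
theorem hasCycleGE_of_not_crossing (hinj : Set.InjOn p (Set.Iic m))
    (hadj : ∀ i < m, G.Adj (p i) (p (i + 1))) (hG : ∀ v, (G.induce {v}ᶜ).Connected)
    {k : ℕ} (hk3 : 3 ≤ k) (hkm : k ≤ m + 1)
    {X Y : Finset ℕ} (hX : ∀ l, l ∈ X ↔ l ≤ m ∧ G.Adj (p 0) (p l))
    (hY : ∀ l, l ∈ Y ↔ l ≤ m ∧ G.Adj (p m) (p l)) (hXY : k ≤ X.card + Y.card)
    (hcross : ∀ i ∈ Y, ∀ j ∈ X, j ≤ i) : HasCycleGE G k := by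
  have h1X : 1 ∈ X := (hX 1).2 ⟨by omega, by simpa using hadj 0 (by omega)⟩
  have h1Y : m - 1 ∈ Y := (hY _).2 ⟨by omega, by
    have := hadj (m - 1) (by omega)
    rw [show m - 1 + 1 = m by omega] at this
    exact this.symm⟩
  set a := X.max' ⟨1, h1X⟩ with ha
  set b := Y.min' ⟨_, h1Y⟩ with hb
  have haX : a ∈ X := Finset.max'_mem _ _
  have hbY : b ∈ Y := Finset.min'_mem _ _
  have hXa : ∀ l ∈ X, l ≤ a := fun l hl => Finset.le_max' _ _ hl
  have hYb : ∀ l ∈ Y, b ≤ l := fun l hl => Finset.min'_le _ _ hl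
  clear_value a b
  have hab := hcross b hbY a haX
  have ha1 := hXa 1 h1X
  have hb1 := hYb _ h1Y
  obtain ⟨a₁, b₁, f, f', R, R', ha₁, hbb₁, hb₁, hf, hR, hR', hd, hlo, hhi⟩ :=
    linked (G := G) hinj hadj hG (a := a) (b := b) (by omega) hab (by omega)
  obtain ⟨I, hI, hIsub, hI0, hIX⟩ := exists_pathOn_initial hinj hadj ha₁ (by omega)
    ((hX a).1 haX).2
  obtain ⟨J, hJ, hJsub, hJm, hJY⟩ := exists_pathOn_final hinj hadj hbb₁ hb₁ ((hY b).1 hbY).2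
  have hne : ∀ {i j}, i ≤ m → j ≤ m → p i = p j → i = j :=
    fun hi hj he => hinj hi hj he
  have hI' : PathOn G (p f') (p f) (I.image p) := by
    rcases hf with ⟨rfl, rfl⟩ | ⟨rfl, rfl⟩
    · exact hI
    · exact hI.symm
  have hfR' : p f ∉ R' := fun h => Finset.disjoint_left.1 hd hR.left_mem h
  have hfR : p f' ∉ R := fun h => Finset.disjoint_left.1 hd h hR'.left_mem
  have hbR' : p b ∉ R' := fun h => Finset.disjoint_left.1 hd hR.right_mem h
  have hbR : p b₁ ∉ R := fun h => Finset.disjoint_left.1 hd h hR'.right_mem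
  have hIm : ∀ z ∈ I.image p, z ∈ R ∪ R' → z = p f ∨ z = p f' := by
    intro z hz hz'
    obtain ⟨l, hl, rfl⟩ := Finset.mem_image.1 hz
    have hl2 := Finset.mem_Icc.1 (hIsub hl)
    rcases hl2.2.lt_or_eq with h | rfl
    · have := hlo l h hz'
      subst this
      rcases hf with ⟨rfl, rfl⟩ | ⟨rfl, rfl⟩ <;> simp
    · rcases hf with ⟨rfl, rfl⟩ | ⟨rfl, rfl⟩ <;> simp
  have hJm' : ∀ z ∈ J.image p, z ∈ R ∪ R' → z = p b ∨ z = p b₁ := by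
    intro z hz hz'
    obtain ⟨l, hl, rfl⟩ := Finset.mem_image.1 hz
    have hl2 := Finset.mem_Icc.1 (hJsub hl)
    rcases hl2.1.lt_or_eq with h | rfl
    · have := hhi l h hl2.2 hz'
      subst this
      exact Or.inr rfl
    · exact Or.inl rfl
  have h1 := hI'.trans hR (by
    intro z hz
    rw [Finset.mem_inter] at hz
    rcases hIm z hz.1 (Finset.mem_union_left _ hz.2) with rfl | rfl
    · simp
    · exact absurd hz.2 hfR)
  have hIJ : ∀ z ∈ I.image p, z ∈ J.image p → z = p a ∧ a = b := by
    intro z hz hz'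
    obtain ⟨l, hl, rfl⟩ := Finset.mem_image.1 hz
    obtain ⟨l', hl', he⟩ := Finset.mem_image.1 hz'
    have hl2 := Finset.mem_Icc.1 (hIsub hl)
    have hl2' := Finset.mem_Icc.1 (hJsub hl')
    have := hne (by omega) (by omega) he
    exact ⟨by rw [show l = a by omega], by omega⟩
  have h2 := h1.trans hJ (by
    intro z hz
    rw [Finset.mem_inter, Finset.mem_union] at hz
    rw [Finset.mem_singleton]
    rcases hz.1 with hz1 | hz1
    · obtain ⟨h, h'⟩ := hIJ z hz1 hz.2
      rw [h, h']
    · rcases hJm' z hz.2 (Finset.mem_union_left _ hz1) with rfl | rfl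
      · rfl
      · exact absurd hz1 hbR)
  have hcard : k ≤ (I.image p ∪ R ∪ J.image p ∪ R').card := by
    have hsub : (insert 0 X ∪ insert m Y).image p ⊆ I.image p ∪ R ∪ J.image p ∪ R' := by
      rw [Finset.image_union]
      refine Finset.union_subset ?_ ?_
      · intro z hz
        obtain ⟨l, hl, rfl⟩ := Finset.mem_image.1 hz
        have : l ∈ I := by
          rcases Finset.mem_insert.1 hl with rfl | hl
          · exact hI0
          · exact hIX l (hXa l hl) ((hX l).1 hl).2
        simp [Finset.mem_image_of_mem p this]
      · intro z hz
        obtain ⟨l, hl, rfl⟩ := Finset.mem_image.1 hz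
        have : l ∈ J := by
          rcases Finset.mem_insert.1 hl with rfl | hl
          · exact hJm
          · exact hJY l (hYb l hl) ((hY l).1 hl).1 ((hY l).1 hl).2
        simp [Finset.mem_image_of_mem p this]
    refine le_trans ?_ (Finset.card_le_card hsub)
    have hle : ∀ l ∈ insert 0 X ∪ insert m Y, l ≤ m := by
      intro l hl
      simp only [Finset.mem_union, Finset.mem_insert] at hl
      rcases hl with (rfl | hl) | (rfl | hl)
      · omega
      · exact ((hX l).1 hl).1
      · exact le_rfl
      · exact ((hY l).1 hl).1
    rw [Finset.card_image_of_injOn (hinj.mono fun l hl => hle l hl)]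
    have h0X : 0 ∉ X := fun h => G.loopless.irrefl _ ((hX 0).1 h).2
    have hmY : m ∉ Y := fun h => G.loopless.irrefl _ ((hY m).1 h).2
    have hu := Finset.card_union_add_card_inter (insert 0 X) (insert m Y)
    -- The two neighbourhoods with their centres share at most the vertex at `a = b`, so the cycle
    -- has at least `(|X| + 1) + (|Y| + 1) - 1` vertices.
    have hi : (insert 0 X ∩ insert m Y).card ≤ 1 := by
      rw [Finset.card_le_one]
      have : ∀ l ∈ insert 0 X ∩ insert m Y, l = a := by
        intro l hl
        simp only [Finset.mem_inter, Finset.mem_insert] at hl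
        have h1 : l ≤ a := by
          rcases hl.1 with rfl | h
          · omega
          · exact hXa _ h
        have h2 : b ≤ l := by
          rcases hl.2 with rfl | h
          · omega
          · exact hYb _ h
        omega
      intro x hx y hy
      rw [this x hx, this y hy]
    rw [Finset.card_insert_of_notMem h0X, Finset.card_insert_of_notMem hmY] at hu
    omega
  refine h2.hasCycleGE_of_two hR' ?_ ?_ (hk3.trans hcard) hcard
  · intro he
    have := hne (by omega) (by omega) he
    omega
  · intro z hz
    rw [Finset.mem_inter, Finset.mem_union, Finset.mem_union] at hz
    rw [Finset.mem_insert, Finset.mem_singleton]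
    rcases hz.1 with (h | h) | h
    · rcases hIm z h (Finset.mem_union_right _ hz.2) with rfl | rfl
      · exact absurd hz.2 hfR'
      · exact Or.inl rfl
    · exact absurd hz.2 (Finset.disjoint_left.1 hd h)
    · rcases hJm' z h (Finset.mem_union_right _ hz.2) with rfl | rfl
      · exact absurd hz.2 hbR'
      · exact Or.inr rfl

end Index

/-- **Kopylov's lemma**: in a graph without cut vertices, a path on at least `k` vertices whose
ends have together at least `k` neighbours on it yields a cycle of length at least `k`. -/
theorem PathOn.hasCycleGE_of_degIn (hG : ∀ v, (G.induce {v}ᶜ).Connected) {x y : V} {S : Finset V}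
    (hS : PathOn G x y S) {k : ℕ} (hk3 : 3 ≤ k) (hkS : k ≤ S.card)
    (hdeg : k ≤ degIn G S x + degIn G S y) : HasCycleGE G k := by
  classical
  obtain ⟨m, p, rfl, rfl, rfl, hinj, hadj⟩ := hS.exists_index
  have hI : Set.InjOn p (Finset.range (m + 1) : Finset ℕ) :=
    hinj.mono fun l hl => by simp at hl ⊢; omega
  rw [Finset.card_image_of_injOn hI, Finset.card_range] at hkS
  have hcard : ∀ v, degIn G ((Finset.range (m + 1)).image p) v =
      ((Finset.range (m + 1)).filter fun l => G.Adj v (p l)).card := by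
    intro v
    rw [degIn, Finset.filter_image, Finset.card_image_of_injOn
      (hI.mono (Finset.coe_subset.2 (Finset.filter_subset _ _)))]
  rw [hcard, hcard] at hdeg
  have hX : ∀ v l, (l ∈ (Finset.range (m + 1)).filter fun l => G.Adj v (p l)) ↔
      l ≤ m ∧ G.Adj v (p l) := by
    intro v l; rw [Finset.mem_filter, Finset.mem_range, Nat.lt_succ_iff]
  by_cases hcross : ∃ i ∈ (Finset.range (m + 1)).filter fun l => G.Adj (p m) (p l),
      ∃ j ∈ (Finset.range (m + 1)).filter fun l => G.Adj (p 0) (p l), i < j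
  · exact hasCycleGE_of_crossing hinj hadj hk3 hkS (hX _) (hX _) hdeg hcross
  · push Not at hcross
    exact hasCycleGE_of_not_crossing hinj hadj hG hk3 hkS (hX _) (hX _) hdeg hcross

end SpectralCycles

/-! ### Cores, edge-maximal graphs and Kopylov's theorem -/

namespace SpectralCycles

theorem degIn_mono {V : Type*} {G G' : SimpleGraph V} (hle : G ≤ G') {S T : Finset V}
    (hST : S ⊆ T) (v : V) : degIn G S v ≤ degIn G' T v := by
  classical
  refine Finset.card_le_card fun x hx => ?_
  rw [Finset.mem_filter] at hx ⊢
  exact ⟨hST hx.1, hle hx.2⟩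

/-- The `(s + 1)`-core of `G` has at most `m` vertices: every larger vertex set spans a vertex of
degree at most `s`. -/
def CoreLE {V : Type*} (G : SimpleGraph V) (s m : ℕ) : Prop :=
  ∀ T : Finset V, m < T.card → ∃ v ∈ T, degIn G T v ≤ s

theorem CoreLE.anti {V : Type*} {G G' : SimpleGraph V} {s m : ℕ} (h : CoreLE G' s m)
    (hle : G ≤ G') : CoreLE G s m := fun T hT => by
  obtain ⟨v, hv, hd⟩ := h T hT
  exact ⟨v, hv, (degIn_mono hle le_rfl v).trans hd⟩

theorem TwoConnected.mono {V : Type*} [Fintype V] {G G' : SimpleGraph V} (h : TwoConnected G)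
    (hle : G ≤ G') : TwoConnected G' :=
  ⟨h.1, h.2.1.mono hle, fun v => (h.2.2 v).mono fun _ _ hab => hle hab⟩

variable {V : Type*} [DecidableEq V] {G : SimpleGraph V}

/-- A path uses the new edge at most once: after crossing it, the remainder misses one of its ends
and so lies in `G`. -/
theorem PathOn.of_sup_edge {x y u v : V} {S : Finset V}
    (h : PathOn (G ⊔ SimpleGraph.edge x y) u v S) :
    PathOn G u v S ∨ ∃ S₁ S₂, S₁ ∪ S₂ = S ∧ Disjoint S₁ S₂ ∧
      ((PathOn G u x S₁ ∧ PathOn G y v S₂) ∨ (PathOn G u y S₁ ∧ PathOn G x v S₂)) := by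
  have avoid : ∀ {u v : V} {S : Finset V}, PathOn (G ⊔ SimpleGraph.edge x y) u v S →
      (x ∉ S ∨ y ∉ S) → PathOn G u v S := by
    intro u v S h hxy
    refine h.mono fun a ha b hb hab => ?_
    rw [SimpleGraph.sup_adj, SimpleGraph.edge_adj] at hab
    rcases hab with hab | ⟨⟨rfl, rfl⟩ | ⟨rfl, rfl⟩, -⟩
    · exact hab
    · tauto
    · tauto
  induction h with
  | single v => exact Or.inl (.single v)
  | @cons a b c S hab hp hn ih =>
    rw [SimpleGraph.sup_adj, SimpleGraph.edge_adj] at hab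
    rcases hab with hab | ⟨⟨rfl, rfl⟩ | ⟨rfl, rfl⟩, -⟩
    · rcases ih with ih | ⟨S₁, S₂, hu, hd, ih⟩
      · exact Or.inl (.cons hab ih hn)
      · have ha1 : a ∉ S₁ := fun h => hn (hu ▸ Finset.mem_union_left _ h)
        have ha2 : a ∉ S₂ := fun h => hn (hu ▸ Finset.mem_union_right _ h)
        refine Or.inr ⟨insert a S₁, S₂, by rw [Finset.insert_union, hu],
          Finset.disjoint_insert_left.2 ⟨ha2, hd⟩, ?_⟩
        rcases ih with ⟨h1, h2⟩ | ⟨h1, h2⟩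
        · exact Or.inl ⟨.cons hab h1 ha1, h2⟩
        · exact Or.inr ⟨.cons hab h1 ha1, h2⟩
    · exact Or.inr ⟨{a}, S, by rw [Finset.insert_eq], by simpa using hn,
        Or.inl ⟨.single _, avoid hp (Or.inl hn)⟩⟩
    · exact Or.inr ⟨{a}, S, by rw [Finset.insert_eq], by simpa using hn,
        Or.inr ⟨.single _, avoid hp (Or.inr hn)⟩⟩

/-- If adding the edge `xy` creates a long cycle, then `x` and `y` are the ends of a long path. -/
theorem exists_pathOn_of_sup_edge {x y : V} (hxy : x ≠ y) {k : ℕ} (hk : 3 ≤ k)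
    (hG : ¬ HasCycleGE G k) (hG' : HasCycleGE (G ⊔ SimpleGraph.edge x y) k) :
    ∃ S, PathOn G x y S ∧ k ≤ S.card := by
  obtain ⟨v, c, hc, hkc⟩ := hG'
  obtain ⟨w, hp, hvw, hcard⟩ := PathOn.of_isCycle hc c.start_mem_support
  rw [← hcard] at hkc
  generalize c.support.toFinset = S at *
  rw [SimpleGraph.sup_adj, SimpleGraph.edge_adj] at hvw
  rcases hp.of_sup_edge with h | ⟨S₁, S₂, hu, hd, h⟩
  · rcases hvw with hvw | ⟨⟨rfl, rfl⟩ | ⟨rfl, rfl⟩, -⟩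
    · exact absurd (h.hasCycleGE hvw (hk.trans hkc) hkc) hG
    · exact ⟨S, h.symm, hkc⟩
    · exact ⟨S, h, hkc⟩
  · have hsmall : ∀ {a b : V}, PathOn G a a S₁ → PathOn G b b S₂ → False := by
      intro a b h1 h2
      have := Finset.card_union_le S₁ S₂
      rw [hu, h1.eq_singleton, h2.eq_singleton] at this
      simp at this; omega
    have hmem : ∀ {a}, a ∈ S₁ → a ∈ S₂ → False := fun h1 h2 => Finset.disjoint_left.1 hd h1 h2
    rcases hvw with hvw | ⟨⟨rfl, rfl⟩ | ⟨rfl, rfl⟩, -⟩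
    · rcases h with ⟨h1, h2⟩ | ⟨h1, h2⟩
      · have := h2.append hvw h1 hd.symm
        rw [Finset.union_comm, hu] at this
        exact ⟨S, this.symm, hkc⟩
      · have := h2.append hvw h1 hd.symm
        rw [Finset.union_comm, hu] at this
        exact ⟨S, this, hkc⟩
    · rcases h with ⟨h1, h2⟩ | ⟨h1, h2⟩
      · exact (hmem h1.left_mem h2.left_mem).elim
      · exact (hsmall h1 h2).elim
    · rcases h with ⟨h1, h2⟩ | ⟨h1, h2⟩
      · exact (hsmall h1 h2).elim
      · exact (hmem h1.left_mem h2.left_mem).elim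

theorem PathOn.of_clique {H : Finset V} (hH : ∀ a ∈ H, ∀ b ∈ H, a ≠ b → G.Adj a b) {a b : V}
    (ha : a ∈ H) (hb : b ∈ H) (hab : a ≠ b) : PathOn G a b H := by
  induction H using Finset.strongInduction generalizing a with
  | H H ih =>
    by_cases hex : ∃ c ∈ H.erase a, c ≠ b
    · obtain ⟨c, hc, hcb⟩ := hex
      have := ih (H.erase a) (Finset.erase_ssubset ha)
        (fun x hx y hy => hH x (Finset.mem_of_mem_erase hx) y (Finset.mem_of_mem_erase hy)) hc
        (Finset.mem_erase.2 ⟨hab.symm, hb⟩) hcb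
      have h2 := PathOn.cons (hH a ha c (Finset.mem_of_mem_erase hc)
        (Finset.ne_of_mem_erase hc).symm) this (Finset.notMem_erase a H)
      rwa [Finset.insert_erase ha] at h2
    · push Not at hex
      have : H = insert a {b} := by
        ext x
        simp only [Finset.mem_insert, Finset.mem_singleton]
        constructor
        · intro hx
          by_cases hxa : x = a
          · exact Or.inl hxa
          · exact Or.inr (hex x (Finset.mem_erase.2 ⟨hxa, hx⟩))
        · rintro (rfl | rfl) <;> assumption
      rw [this]
      exact .cons (hH a ha b hb hab) (.single b) (by simpa using hab)

/-- A graph without long cycles in which each new edge creates one: vertex sets of large minimum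
degree are completely joined. -/
theorem adj_of_degIn [Finite V] (hG : ∀ v, (G.induce {v}ᶜ).Connected) {k : ℕ} (hk : 3 ≤ k)
    (hfree : ¬ HasCycleGE G k)
    (hsat : ∀ x y, x ≠ y → ¬ G.Adj x y → ∃ S, PathOn G x y S ∧ k ≤ S.card)
    {X Y : Finset V} {α β : ℕ} (hαβ : k ≤ α + β) (hX : ∀ x ∈ X, α ≤ degIn G X x)
    (hY : ∀ y ∈ Y, β ≤ degIn G Y y) {x y : V} (hx : x ∈ X) (hy : y ∈ Y) (hxy : x ≠ y) :
    G.Adj x y := by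
  classical
  have := Fintype.ofFinite V
  by_contra hna
  -- Minimising `d` selects a nonadjacent pair whose connecting path is longest.
  have hex : ∃ d, ∃ x ∈ X, ∃ y ∈ Y, x ≠ y ∧ ¬ G.Adj x y ∧ ∃ S, PathOn G x y S ∧ k ≤ S.card ∧
      Fintype.card V - S.card = d := by
    obtain ⟨S, hS, hkS⟩ := hsat x y hxy hna
    exact ⟨_, x, hx, y, hy, hxy, hna, S, hS, hkS, rfl⟩
  clear! x y
  obtain ⟨x, hx, y, hy, hxy, hna, S, hS, hkS, hd⟩ := Nat.find_spec hex
  have hmax : ∀ x ∈ X, ∀ y ∈ Y, x ≠ y → ¬ G.Adj x y → ∀ T, PathOn G x y T → k ≤ T.card →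
      T.card ≤ S.card := by
    intro x hx y hy hxy hna T hT hkT
    have := Nat.find_min' hex ⟨x, hx, y, hy, hxy, hna, T, hT, hkT, rfl⟩
    have h1 := Finset.card_le_univ S
    have h2 := Finset.card_le_univ T
    omega
  clear hd
  have hclosed : ∀ {a b : V} {T : Finset V}, PathOn G a b T → k ≤ T.card → ¬ G.Adj a b :=
    fun h hkT hab => hfree (h.hasCycleGE hab.symm (hk.trans hkT) hkT)
  -- All neighbours of `x` in `X` lie on the longest path. A neighbour off it could be prepended,
  -- and the new ends would again be nonadjacent, since an edge between them would close a long
  -- cycle. The same holds for `y` and `Y`.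
  refine hfree (hS.hasCycleGE_of_degIn hG hk hkS (hαβ.trans (Nat.add_le_add
    ((hX x hx).trans ?_) ((hY y hy).trans ?_))))
  · refine Finset.card_le_card fun z hz => ?_
    rw [Finset.mem_filter] at hz ⊢
    refine ⟨by_contra fun hzS => ?_, hz.2⟩
    have hT := PathOn.cons hz.2.symm hS hzS
    have hc := Finset.card_insert_of_notMem hzS
    have := hmax z hz.1 y hy (fun h => hzS (h ▸ hS.right_mem)) (hclosed hT (by omega)) _ hT
      (by omega)
    omega
  · refine Finset.card_le_card fun z hz => ?_
    rw [Finset.mem_filter] at hz ⊢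
    refine ⟨by_contra fun hzS => ?_, hz.2⟩
    have hT := (PathOn.cons hz.2.symm hS.symm hzS).symm
    have hc := Finset.card_insert_of_notMem hzS
    have := hmax x hx z hz.1 (fun h => hzS (h ▸ hS.left_mem)) (hclosed hT (by omega)) _ hT
      (by omega)
    omega

/-- A large clique of a 2-connected graph lies on a cycle with one more vertex. -/
theorem hasCycleGE_of_clique (hconn : G.Connected) (hG : ∀ v, (G.induce {v}ᶜ).Connected)
    {H : Finset V} (hH : ∀ a ∈ H, ∀ b ∈ H, a ≠ b → G.Adj a b) (hcard : 2 ≤ H.card) {z₀ : V}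
    (hz₀ : z₀ ∉ H) : HasCycleGE G (H.card + 1) := by
  obtain ⟨h₀, hh₀⟩ := Finset.card_pos.1 (by omega : 0 < H.card)
  obtain ⟨z, h, hz, hh, hzh⟩ : ∃ z h, z ∉ H ∧ h ∈ H ∧ G.Adj h z := by
    obtain ⟨p⟩ := hconn.preconnected h₀ z₀
    obtain ⟨d, -, hd1, hd2⟩ := p.exists_boundary_dart (H : Set V) (by simpa) (by simpa)
    exact ⟨d.snd, d.fst, by simpa using hd2, by simpa using hd1, d.adj⟩
  obtain ⟨a, ha, b, hb, S, hS, hhS, -, hSH⟩ := exists_pathOn_between (hG h) (A := {z})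
    (B := H.erase h) (by simp) (Finset.card_pos.1 (by rw [Finset.card_erase_of_mem hh]; omega))
    (by simpa using hzh.ne) (by simp)
  obtain rfl : a = z := by simpa using ha
  have hbH := Finset.mem_erase.1 hb
  have h1 := hS.trans (PathOn.of_clique hH hbH.2 hh hbH.1) (by
    intro x hx
    rw [Finset.mem_inter] at hx
    refine hSH (Finset.mem_inter.2 ⟨hx.1, Finset.mem_erase.2 ⟨?_, hx.2⟩⟩)
    rintro rfl
    exact hhS hx.1)
  have hc : H.card + 1 ≤ (S ∪ H).card := by
    rw [← Finset.card_insert_of_notMem hz]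
    refine Finset.card_le_card (Finset.insert_subset ?_ Finset.subset_union_right)
    exact Finset.mem_union_left _ hS.left_mem
  exact h1.hasCycleGE hzh (by omega) hc

/-- Suppose every level fails. Failure at `s = t` gives a largest set `H` of more than `k - t`
vertices with minimum degree at least `t + 1`, a clique because `2 * (t + 1) ≥ k`. If `|H| ≥ k - 1`,
a long cycle exists; otherwise failure at `s = k - |H|` enlarges `H`. -/
theorem exists_coreLE_of_saturated [Fintype V] (h2 : TwoConnected G) {k : ℕ} (hk : 5 ≤ k)
    (hkn : k ≤ Fintype.card V) (hfree : ¬ HasCycleGE G k)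
    (hsat : ∀ x y, x ≠ y → ¬ G.Adj x y → ∃ S, PathOn G x y S ∧ k ≤ S.card) :
    ∃ s, 2 ≤ s ∧ s ≤ (k - 1) / 2 ∧ CoreLE G s (k - s) := by
  classical
  by_contra! hcon
  obtain ⟨-, hconn, hG⟩ := h2
  set t := (k - 1) / 2 with ht
  obtain ⟨T, hTcard, hT⟩ : ∃ T : Finset V, k - t < T.card ∧ ∀ v ∈ T, t + 1 ≤ degIn G T v := by
    have := hcon t (by omega) le_rfl
    rw [CoreLE] at this
    push Not at this
    exact this
  have hne : (Finset.univ.filter fun T : Finset V =>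
      k - t < T.card ∧ ∀ v ∈ T, t + 1 ≤ degIn G T v).Nonempty := ⟨T, by simpa using ⟨hTcard, hT⟩⟩
  obtain ⟨H, hHmem, hHmax⟩ := Finset.exists_max_image _ Finset.card hne
  simp only [Finset.mem_filter, Finset.mem_univ, true_and] at hHmem hHmax
  obtain ⟨hHcard, hH⟩ := hHmem
  clear hne hTcard hT T
  have hclique : ∀ a ∈ H, ∀ b ∈ H, a ≠ b → G.Adj a b := fun a ha b hb hab =>
    adj_of_degIn hG (by omega) hfree hsat (by omega) hH hH ha hb hab
  have hHdeg : ∀ a ∈ H, H.card - 1 ≤ degIn G H a := by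
    intro a ha
    rw [← Finset.card_erase_of_mem ha]
    refine Finset.card_le_card fun b hb => ?_
    rw [Finset.mem_erase] at hb
    exact Finset.mem_filter.2 ⟨hb.2, hclique a ha b hb.2 hb.1.symm⟩
  rcases le_or_gt (k - 1) H.card with hr | hr
  · by_cases hz : ∃ z, z ∉ H
    · obtain ⟨z, hz⟩ := hz
      obtain ⟨v, c, hc, hl⟩ := hasCycleGE_of_clique hconn hG hclique (by omega) hz
      exact hfree ⟨v, c, hc, by omega⟩
    · push Not at hz
      have hcard : H.card = Fintype.card V := by rw [Finset.eq_univ_iff_forall.2 hz]; rfl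
      obtain ⟨a, ha, b, hb, hab⟩ := Finset.one_lt_card.1 (by omega : 1 < H.card)
      exact hfree ((PathOn.of_clique hclique ha hb hab).hasCycleGE (hclique b hb a ha hab.symm)
        (by omega) (by omega))
  · obtain ⟨T, hTcard, hT⟩ : ∃ T : Finset V, H.card < T.card ∧
        ∀ v ∈ T, k - H.card + 1 ≤ degIn G T v := by
      have := hcon (k - H.card) (by omega) (by omega)
      rw [CoreLE, show k - (k - H.card) = H.card by omega] at this
      push Not at this
      exact this
    -- The clique `H` has internal degree `|H| - 1`, the exact complement to `k` of the degree bound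
    -- `k - |H| + 1` here. Hence a vertex of `T` outside `H` is joined to all of `H`.
    have hT' : ∀ v ∈ H ∪ T, k - H.card + 1 ≤ degIn G (H ∪ T) v := by
      intro v hv
      rcases Finset.mem_union.1 hv with hv | hv
      · have h1 := hH v hv
        have h2 := degIn_mono (le_refl G) (Finset.subset_union_left (s₁ := H) (s₂ := T)) v
        omega
      · exact (hT v hv).trans (degIn_mono le_rfl Finset.subset_union_right v)
    obtain ⟨y, hyT, hyH⟩ : ∃ y ∈ T, y ∉ H := by
      by_contra! hsub
      have := Finset.card_le_card (fun x hx => hsub x hx : T ⊆ H)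
      omega
    have hadj : ∀ x ∈ H, G.Adj x y := fun x hx =>
      adj_of_degIn hG (by omega) hfree hsat (by omega) hHdeg hT' hx
        (Finset.mem_union_right _ hyT) (by rintro rfl; exact hyH hx)
    have hc := Finset.card_insert_of_notMem hyH
    have := hHmax (insert y H) ⟨by omega, by
      intro v hv
      rcases Finset.mem_insert.1 hv with rfl | hv
      · refine le_trans (by omega : t + 1 ≤ H.card) (Finset.card_le_card fun x hx => ?_)
        exact Finset.mem_filter.2 ⟨Finset.mem_insert_of_mem hx, (hadj x hx).symm⟩
      · exact (hH v hv).trans (degIn_mono le_rfl (Finset.subset_insert _ _) v)⟩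
    omega

/-- **Kopylov's theorem**, core form. -/
theorem exists_coreLE {V : Type*} [Fintype V] {G : SimpleGraph V} (h2 : TwoConnected G) {k : ℕ}
    (hk : 5 ≤ k) (hkn : k ≤ Fintype.card V) (hfree : ¬ HasCycleGE G k) :
    ∃ s, 2 ≤ s ∧ s ≤ (k - 1) / 2 ∧ CoreLE G s (k - s) := by
  classical
  -- Pass to a maximal graph without long cycles: 2-connectedness survives added edges, and the core
  -- bound descends to subgraphs.
  obtain ⟨M, hGM, hM⟩ := (Set.toFinite {G : SimpleGraph V | ¬ HasCycleGE G k}).exists_le_maximal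
    (a := G) hfree
  obtain ⟨s, h1, h2, h3⟩ := exists_coreLE_of_saturated (h2.mono hGM) hk hkn hM.prop
    fun x y hxy hna => exists_pathOn_of_sup_edge hxy (by omega) hM.prop (by
      by_contra hcon
      have := hM.le_of_ge (y := M ⊔ SimpleGraph.edge x y) hcon le_sup_left
      exact hna (this (by simp [SimpleGraph.edge_adj, hxy])))
  exact ⟨s, h1, h2, h3.anti hGM⟩

end SpectralCycles

namespace SpectralCycles

/-! ### Rayleigh quotient of the signless Laplacian -/

section Variational

variable {V : Type*} [Fintype V]

open Classical in
/-- Twice the quadratic form of the signless Laplacian. -/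
noncomputable def edgeForm (G : SimpleGraph V) (x : V → ℝ) : ℝ :=
  ∑ i, ∑ j, if G.Adj i j then (x i + x j) ^ 2 else 0

open Classical in
theorem edgeForm_eq (G : SimpleGraph V) (x : V → ℝ) :
    edgeForm G x = 2 * (x ⬝ᵥ (signlessLap G).mulVec x) := by
  have h1 : x ⬝ᵥ (signlessLap G).mulVec x =
      ∑ i, ∑ j, if G.Adj i j then (x i ^ 2 + x i * x j) else 0 := by
    rw [dotProduct]
    refine Finset.sum_congr rfl fun i _ => ?_
    rw [signlessLap, Matrix.add_mulVec, Pi.add_apply, SimpleGraph.degMatrix,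
      Matrix.mulVec_diagonal, SimpleGraph.adjMatrix_mulVec_apply, ← SimpleGraph.card_neighborFinset_eq_degree,
      Finset.card_eq_sum_ones, SimpleGraph.neighborFinset_eq_filter, Finset.sum_filter,
      Finset.sum_filter, Nat.cast_sum, Finset.sum_mul, ← Finset.sum_add_distrib, Finset.mul_sum]
    refine Finset.sum_congr rfl fun j _ => ?_
    split_ifs <;> simp; ring
  have h2 : x ⬝ᵥ (signlessLap G).mulVec x =
      ∑ i, ∑ j, if G.Adj i j then (x j ^ 2 + x i * x j) else 0 := by
    rw [h1, Finset.sum_comm]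
    refine Finset.sum_congr rfl fun i _ => Finset.sum_congr rfl fun j _ => ?_
    simp only [G.adj_comm j i, mul_comm]
  rw [two_mul]
  nth_rewrite 1 [h1]
  rw [h2, ← Finset.sum_add_distrib, edgeForm]
  refine Finset.sum_congr rfl fun i _ => ?_
  rw [← Finset.sum_add_distrib]
  refine Finset.sum_congr rfl fun j _ => ?_
  split_ifs <;> ring

open Classical in
theorem edgeForm_le [Nonempty V] (G : SimpleGraph V) (x : V → ℝ) :
    edgeForm G x ≤ 2 * (q G * (x ⬝ᵥ x)) := by
  have hS : (signlessLap G).IsHermitian := by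
    refine Matrix.IsHermitian.add ?_ ?_
    · exact Matrix.isHermitian_diagonal_of_self_adjoint _ (by ext; simp)
    · ext i j
      simp [SimpleGraph.adjMatrix_apply, SimpleGraph.adj_comm]
  have hH : (q G • (1 : Matrix V V ℝ) - signlessLap G).IsHermitian := by
    refine Matrix.IsHermitian.sub ?_ hS
    ext i j
    simp [Matrix.one_apply, eq_comm]
  have hpos : (q G • (1 : Matrix V V ℝ) - signlessLap G).PosSemidef := by
    rw [hH.posSemidef_iff_eigenvalues_nonneg]
    intro i
    have h1 := hH.mulVec_eigenvectorBasis i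
    set μ := hH.eigenvalues i
    set u := hH.eigenvectorBasis i with hu
    have hu0 : (u : V → ℝ) ≠ 0 := by
      intro h0
      have h2 := hH.eigenvectorBasis.orthonormal.ne_zero i
      apply h2
      ext j
      exact congrFun h0 j
    -- An eigenvalue `μ` of `q I - (D + A)` makes `q - μ` an eigenvalue of `D + A`, so maximality of
    -- `q` forces `μ ≥ 0`.
    have hev : Module.End.HasEigenvalue (Matrix.toLin' (signlessLap G)) (q G - μ) := by
      refine Module.End.hasEigenvalue_of_hasEigenvector (x := (u : V → ℝ)) ?_
      rw [Module.End.hasEigenvector_iff, Module.End.mem_eigenspace_iff, Matrix.toLin'_apply]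
      refine ⟨?_, hu0⟩
      rw [Matrix.sub_mulVec, Matrix.smul_mulVec, Matrix.one_mulVec] at h1
      rw [sub_smul, ← h1]; abel
    have := (isGreatest_q G).2 hev
    simp only [Pi.zero_apply]
    linarith
  have h := hpos.dotProduct_mulVec_nonneg x
  rw [edgeForm_eq]
  rw [Matrix.sub_mulVec, Matrix.smul_mulVec, Matrix.one_mulVec, dotProduct_sub, dotProduct_smul,
    star_trivial, smul_eq_mul] at h
  linarith

open Classical in
/-- The largest signless Laplacian eigenvalue is a value of the Rayleigh quotient at a nonzero
nonnegative vector. -/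
theorem exists_le_edgeForm [Nonempty V] (G : SimpleGraph V) :
    ∃ x : V → ℝ, 0 ≤ x ∧ 0 < x ⬝ᵥ x ∧ 2 * (q G * (x ⬝ᵥ x)) ≤ edgeForm G x := by
  obtain ⟨u, hu⟩ := (isGreatest_q G).1.exists_hasEigenvector
  rw [Module.End.hasEigenvector_iff, Module.End.mem_eigenspace_iff, Matrix.toLin'_apply] at hu
  have hnorm : (fun i => |u i|) ⬝ᵥ (fun i => |u i|) = u ⬝ᵥ u := by
    simp [dotProduct]
  -- Absolute values keep the norm of the eigenvector and can only increase each `(u i + u j) ^ 2`.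
  refine ⟨fun i => |u i|, fun i => abs_nonneg _, ?_, ?_⟩
  · rw [hnorm]
    have h0 : u ⬝ᵥ u ≠ 0 := fun h => hu.2 (dotProduct_self_eq_zero.1 h)
    have h1 : 0 ≤ u ⬝ᵥ u := Finset.sum_nonneg fun i _ => mul_self_nonneg _
    exact lt_of_le_of_ne h1 h0.symm
  · rw [hnorm]
    have h1 : edgeForm G u = 2 * (q G * (u ⬝ᵥ u)) := by
      rw [edgeForm_eq, hu.1, dotProduct_smul, smul_eq_mul]
    rw [← h1]
    refine Finset.sum_le_sum fun i _ => Finset.sum_le_sum fun j _ => ?_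
    split_ifs
    · refine sq_le_sq.2 ?_
      rw [abs_of_nonneg (add_nonneg (abs_nonneg (u i)) (abs_nonneg (u j)))]
      exact abs_add_le _ _
    · exact le_rfl

end Variational

/-! ### Transport of the core condition along embeddings -/

section Core

theorem degIn_comap {α β : Type*} (G : SimpleGraph β) (f : α ↪ β) (T : Finset α) (a : α) :
    degIn (G.comap f) T a = degIn G (T.map f) (f a) := by
  classical
  rw [degIn, degIn, Finset.filter_map, Finset.card_map]
  rfl

theorem degIn_eq_zero {V : Type*} {G : SimpleGraph V} {T : Finset V} {v : V}
    (h : ∀ w ∈ T, ¬ G.Adj v w) : degIn G T v = 0 := by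
  classical
  exact Finset.card_eq_zero.2 (Finset.filter_eq_empty_iff.2 h)

theorem CoreLE.comap {α β : Type*} {G : SimpleGraph β} {s m : ℕ} (h : CoreLE G s m) (f : α ↪ β) :
    CoreLE (G.comap f) s m := by
  classical
  intro T hT
  obtain ⟨v, hv, hd⟩ := h (T.map f) (by rwa [Finset.card_map])
  obtain ⟨a, ha, rfl⟩ := Finset.mem_map.1 hv
  exact ⟨a, ha, (degIn_comap G f T a).trans_le hd⟩

/-- A vertex outside the image is isolated, so only sets inside the image matter. This moves `G` to
a graph on `ℕ`, where vertices can be ordered by weight. -/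
theorem CoreLE.map {α β : Type*} {G : SimpleGraph α} {s m : ℕ} (h : CoreLE G s m) (f : α ↪ β) :
    CoreLE (G.map f) s m := by
  classical
  intro T hT
  by_cases hex : ∃ v ∈ T, v ∉ Set.range f
  · obtain ⟨v, hv, hvf⟩ := hex
    refine ⟨v, hv, ?_⟩
    rw [degIn_eq_zero fun w _ hw => ?_]
    · exact Nat.zero_le _
    · obtain ⟨a, b, -, rfl, -⟩ := (SimpleGraph.map_adj _ _ _ _).1 hw
      exact hvf ⟨a, rfl⟩
  · push Not at hex
    have hTf : (T.preimage f f.injective.injOn).map f = T := by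
      ext x
      simp only [Finset.mem_map, Finset.mem_preimage]
      constructor
      · rintro ⟨a, ha, rfl⟩; exact ha
      · intro hx
        obtain ⟨a, rfl⟩ := hex x hx
        exact ⟨a, hx, rfl⟩
    obtain ⟨a, ha, hd⟩ := h (T.preimage f f.injective.injOn) (by
      rwa [← Finset.card_map f, hTf])
    refine ⟨f a, Finset.mem_preimage.1 ha, le_trans (le_of_eq ?_) hd⟩
    rw [← hTf, ← degIn_comap, SimpleGraph.comap_map_eq, hTf]

end Core

/-! ### Counting edges inside threshold graphs -/

section Counting

open Classical in
/-- The number of ordered pairs below `l` in the relation `r`. -/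
noncomputable def pairCount (r : ℕ → ℕ → Prop) (l : ℕ) : ℕ :=
  ((Finset.range l ×ˢ Finset.range l).filter fun e => r e.1 e.2).card

open Classical in
theorem pairCount_succ {r : ℕ → ℕ → Prop} (hs : ∀ i j, r i j → r j i) (hi : ∀ i, ¬ r i i) (l : ℕ) :
    pairCount r (l + 1) = pairCount r l + 2 * ((Finset.range l).filter (r l)).card := by
  simp only [pairCount, Finset.card_filter, Finset.sum_product, Finset.sum_range_succ,
    Finset.sum_add_distrib, if_neg (hi l)]
  have : ∀ i, (if r i l then 1 else 0) = if r l i then 1 else 0 := fun i => by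
    rw [propext ⟨hs i l, hs l i⟩]
  simp only [this]
  ring

theorem pairCount_comap {r : ℕ → ℕ → Prop} (σ : Equiv.Perm ℕ) {l : ℕ}
    (hσ : ∀ i, σ i < l ↔ i < l) :
    pairCount (fun i j => r (σ i) (σ j)) l = pairCount r l := by
  classical
  refine Finset.card_equiv (Equiv.prodCongr σ σ) fun e => ?_
  simp [hσ]

/-- Among the subgraphs of a threshold graph `T` on `{0, …, l - 1}` whose `(s + 1)`-core has at
most `m` vertices, the one cut out by `W` has most edges. -/
theorem pairCount_le {T : ℕ → ℕ → Prop} (hTs : ∀ i j, T i j → T j i)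
    (hTd : ∀ i j i' j', T i j → i' ≤ i → j' ≤ j → i' ≠ j' → T i' j') {s m l : ℕ} (hsm : s ≤ m)
    (hml : m ≤ l) {G : SimpleGraph ℕ} (hGT : ∀ i < l, ∀ j < l, G.Adj i j → T i j)
    (hG : CoreLE G s m) :
    pairCount G.Adj l ≤
      pairCount (fun i j => i ≠ j ∧ ((i < m ∧ j < m) ∨ i < s ∨ j < s) ∧ T i j) l := by
  classical
  induction l, hml using Nat.le_induction generalizing G with
  | base =>
    refine Finset.card_le_card fun e he => ?_
    simp only [Finset.mem_filter, Finset.mem_product, Finset.mem_range] at he ⊢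
    exact ⟨he.1, he.2.ne, Or.inl he.1, hGT _ he.1.1 _ he.1.2 he.2⟩
  | succ l hml ih =>
    -- The bound is the number of edges that `W` gains in `T` at the last vertex `l`. If `l` is
    -- `T`-related to every `i < s`, this number is `s` and the core condition supplies `v`.
    -- Otherwise downward closure forces all neighbours of `l` below `s`, and `v = l` works.
    have hdeg : ∃ v < l + 1, degIn G (Finset.range (l + 1)) v ≤
        ((Finset.range l).filter fun i => i < s ∧ T l i).card := by
      obtain ⟨v, hv, hd⟩ := hG (Finset.range (l + 1)) (by rw [Finset.card_range]; omega)
      rw [Finset.mem_range] at hv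
      by_cases hall : ∀ i < s, T l i
      · refine ⟨v, hv, hd.trans ?_⟩
        rw [show (Finset.range l).filter (fun i => i < s ∧ T l i) = Finset.range s by
          ext i
          simp only [Finset.mem_filter, Finset.mem_range]
          exact ⟨fun h => h.2.1, fun h => ⟨by omega, h, hall i h⟩⟩, Finset.card_range]
      · push Not at hall
        obtain ⟨i₀, hi₀, hT⟩ := hall
        refine ⟨l, by omega, Finset.card_le_card fun j hj => ?_⟩
        simp only [Finset.mem_filter, Finset.mem_range] at hj ⊢
        have hTj := hGT l (by omega) j hj.1 hj.2
        have := hj.2.ne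
        refine ⟨by omega, ?_, hTj⟩
        by_contra hjs
        exact hT (hTd _ _ _ _ hTj le_rfl (by omega) (by omega))
    obtain ⟨v, hv, hd⟩ := hdeg
    have hσ : ∀ i, Equiv.swap v l i < l + 1 ↔ i < l + 1 := by
      intro i
      rw [Equiv.swap_apply_def]
      split_ifs <;> omega
    -- Moving `v` to the end puts the old vertex `l` in its place, so the remaining labels only
    -- decrease and the edges stay in `T`.
    have hσle : ∀ i < l, i ≤ Equiv.swap v l i := by
      intro i hi
      rw [Equiv.swap_apply_def]
      split_ifs <;> omega
    have hlast : degIn (G.comap (Equiv.swap v l)) (Finset.range l) l ≤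
        degIn G (Finset.range (l + 1)) v := by
      rw [degIn, degIn, ← Finset.card_map (Equiv.swap v l).toEmbedding]
      refine Finset.card_le_card fun j hj => ?_
      obtain ⟨i, hi, rfl⟩ := Finset.mem_map.1 hj
      simp only [Finset.mem_filter, Finset.mem_range, SimpleGraph.comap_adj,
        Equiv.swap_apply_right, Equiv.coe_toEmbedding] at hi ⊢
      exact ⟨(hσ i).2 (by omega), hi.2⟩
    have hc := pairCount_comap (r := G.Adj) (Equiv.swap v l) hσ
    have h1 : pairCount (G.comap (Equiv.swap v l)).Adj (l + 1) =
        pairCount (G.comap (Equiv.swap v l)).Adj l +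
          2 * degIn (G.comap (Equiv.swap v l)) (Finset.range l) l :=
      pairCount_succ (fun _ _ h => h.symm) (fun i => SimpleGraph.irrefl _) l
    have h2 := ih (G := G.comap (Equiv.swap v l)) (fun i hi j hj hij => by
      have hij' : G.Adj (Equiv.swap v l i) (Equiv.swap v l j) := hij
      refine hTd _ _ _ _ (hGT _ ((hσ i).2 (by omega)) _ ((hσ j).2 (by omega)) hij')
        (hσle i hi) (hσle j hj) ?_
      rintro rfl
      exact hij'.ne rfl) (hG.comap (Equiv.swap v l).toEmbedding)
    have h3 : pairCount (fun i j => i ≠ j ∧ ((i < m ∧ j < m) ∨ i < s ∨ j < s) ∧ T i j) (l + 1) =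
        pairCount (fun i j => i ≠ j ∧ ((i < m ∧ j < m) ∨ i < s ∨ j < s) ∧ T i j) l +
          2 * ((Finset.range l).filter fun i => i < s ∧ T l i).card := by
      rw [pairCount_succ (fun i j h => ⟨h.1.symm, by tauto, hTs _ _ h.2.2⟩) (fun i h => h.1 rfl)]
      congr 3
      ext j
      simp only [Finset.mem_filter, Finset.mem_range]
      refine and_congr_right fun hj => ⟨?_, ?_⟩
      · rintro ⟨-, h, h'⟩
        exact ⟨by omega, h'⟩
      · rintro ⟨h, h'⟩
        exact ⟨by omega, Or.inr (Or.inr h), h'⟩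
    have h4 : pairCount G.Adj (l + 1) = pairCount (G.comap (Equiv.swap v l)).Adj (l + 1) := hc.symm
    omega

/-- Greedy matching: the heaviest element of `A` is matched to an element of `B` at least as heavy.
Deleting both keeps the hypothesis at every level. -/
theorem sum_le_sum_of_card_filter_le {ι : Type*} {w : ι → ℝ} (hw : ∀ i, 0 ≤ w i) {A B : Finset ι}
    (h : ∀ c : ℝ, (A.filter fun i => c ≤ w i).card ≤ (B.filter fun i => c ≤ w i).card) :
    ∑ i ∈ A, w i ≤ ∑ i ∈ B, w i := by
  classical
  induction hn : A.card generalizing A B with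
  | zero =>
    rw [Finset.card_eq_zero.1 hn, Finset.sum_empty]
    exact Finset.sum_nonneg fun i _ => hw i
  | succ n ih =>
    obtain ⟨a, ha, hmax⟩ := A.exists_max_image w (Finset.card_pos.1 (by omega))
    obtain ⟨b, hb⟩ : (B.filter fun i => w a ≤ w i).Nonempty := by
      refine Finset.card_pos.1 (lt_of_lt_of_le (Finset.card_pos.2 ?_) (h (w a)))
      exact ⟨a, Finset.mem_filter.2 ⟨ha, le_refl (w a)⟩⟩
    rw [Finset.mem_filter] at hb
    rw [← Finset.add_sum_erase _ _ ha, ← Finset.add_sum_erase _ _ hb.1]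
    refine add_le_add hb.2 (ih (fun c => ?_) (by rw [Finset.card_erase_of_mem ha]; omega))
    rw [Finset.filter_erase, Finset.filter_erase]
    by_cases hc : c ≤ w a
    · rw [Finset.card_erase_of_mem (Finset.mem_filter.2 ⟨ha, hc⟩),
        Finset.card_erase_of_mem (Finset.mem_filter.2 ⟨hb.1, hc.trans hb.2⟩)]
      exact Nat.sub_le_sub_right (h c) 1
    · rw [Finset.card_eq_zero.2]
      · exact Nat.zero_le _
      · rw [Finset.eq_empty_iff_forall_notMem]
        intro i hi
        rw [Finset.mem_erase, Finset.mem_filter] at hi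
        exact hc (hi.2.2.trans (hmax i hi.2.1))

end Counting

/-! ### Spectral comparison with `W` -/

theorem W_adj_iff {n k s : ℕ} (hsk : 2 * s ≤ k) (i j : Fin n) :
    (W n k s).Adj i j ↔ i.val ≠ j.val ∧
      ((i.val < k - s ∧ j.val < k - s) ∨ i.val < s ∨ j.val < s) := by
  change (i ≠ j ∧ _) ↔ _
  rw [Ne, Fin.ext_iff]
  refine and_congr_right fun _ => ?_
  omega

-- By the greedy matching lemma it suffices to compare numbers of pairs of weight at least `c`. As
-- `y` is nonnegative and decreasing, such pairs form a threshold graph.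
open Classical in
theorem sum_pairs_le {n k s : ℕ} (hsk : 2 * s ≤ k) (hkn : k ≤ n) {G : SimpleGraph ℕ}
    (hG : CoreLE G s (k - s)) {y : ℕ → ℝ} (hy0 : ∀ i, 0 ≤ y i) (hy : Antitone y) :
    (∑ i ∈ Finset.range n, ∑ j ∈ Finset.range n, if G.Adj i j then (y i + y j) ^ 2 else 0) ≤
      edgeForm (W n k s) fun i => y i := by
  have hR : edgeForm (W n k s) (fun i => y i) =
      ∑ i ∈ Finset.range n, ∑ j ∈ Finset.range n,
        if i ≠ j ∧ ((i < k - s ∧ j < k - s) ∨ i < s ∨ j < s) then (y i + y j) ^ 2 else 0 := by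
    rw [edgeForm, Finset.sum_range]
    refine Finset.sum_congr rfl fun i _ => ?_
    rw [Finset.sum_range]
    refine Finset.sum_congr rfl fun j _ => ?_
    simp only [W_adj_iff hsk]
  rw [hR, ← Finset.sum_product', ← Finset.sum_product', ← Finset.sum_filter, ← Finset.sum_filter]
  refine sum_le_sum_of_card_filter_le (w := fun e : ℕ × ℕ => (y e.1 + y e.2) ^ 2)
    (fun e => sq_nonneg _) fun c => ?_
  let T : ℕ → ℕ → Prop := fun i j => c ≤ (y i + y j) ^ 2
  let G' : SimpleGraph ℕ :=
    { Adj := fun i j => G.Adj i j ∧ T i j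
      symm := ⟨fun i j h => ⟨h.1.symm, by simpa only [T, add_comm] using h.2⟩⟩
      loopless := ⟨fun i h => G.irrefl h.1⟩ }
  have := pairCount_le (T := T) (G := G') (s := s) (m := k - s) (l := n)
    (fun i j h => by simpa only [T, add_comm] using h)
    (fun i j i' j' h hi hj _ => h.trans (by
      have := hy hi
      have := hy hj
      have := hy0 i
      have := hy0 j
      gcongr)) (by omega) (by omega) (fun i _ j _ h => h.2) (hG.anti fun _ _ h => h.1)
  rw [Finset.filter_filter, Finset.filter_filter]
  simpa only [pairCount, and_assoc, G', T] using this

/-- Graphs whose `(s + 1)`-core has at most `k - s` vertices have `q` at most that of `W`. -/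
theorem q_le_of_coreLE {V : Type*} [Fintype V] {G : SimpleGraph V} {n k s : ℕ}
    (hV : Fintype.card V = n) (hn : 0 < n) (hsk : 2 * s ≤ k) (hkn : k ≤ n)
    (hG : CoreLE G s (k - s)) : q G ≤ q (W n k s) := by
  classical
  have : Nonempty V := Fintype.card_pos_iff.1 (hV ▸ hn)
  have : Nonempty (Fin n) := ⟨⟨0, hn⟩⟩
  obtain ⟨x, hx0, hxx, hx⟩ := exists_le_edgeForm G
  let e₀ : V ≃ Fin n := Fintype.equivFinOfCardEq hV
  let e : V ≃ Fin n := e₀.trans (Tuple.sort fun i => -x (e₀.symm i)).symm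
  -- The value `0` beyond `n` keeps `y` decreasing because `x` is nonnegative; sorting by `-x` puts
  -- the largest entries first.
  let y : ℕ → ℝ := fun i => if h : i < n then x (e.symm ⟨i, h⟩) else 0
  have hye : ∀ v, y (e v) = x v := fun v => by simp [y]
  have hy0 : ∀ i, 0 ≤ y i := fun i => by
    simp only [y]; split_ifs
    · exact hx0 _
    · exact le_rfl
  have hy : Antitone y := by
    intro i j hij
    by_cases hj : j < n
    · have hm := Tuple.monotone_sort (fun i => -x (e₀.symm i))
        (show (⟨i, by omega⟩ : Fin n) ≤ ⟨j, hj⟩ from hij)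
      simp only [y, hj, show i < n by omega, dif_pos]
      simpa [e] using hm
    · exact le_of_eq_of_le (by simp [y, hj]) (hy0 i)
  let f : V ↪ ℕ := e.toEmbedding.trans Fin.valEmbedding
  have key := sum_pairs_le hsk hkn (hG.map f) hy0 hy
  have hsum : ∀ g : ℕ → ℝ, ∑ i ∈ Finset.range n, g i = ∑ v, g (e v) := fun g => by
    rw [Finset.sum_range]
    exact (Equiv.sum_comp e fun i => g i).symm
  have hL : (∑ i ∈ Finset.range n, ∑ j ∈ Finset.range n,
      if (G.map f).Adj i j then (y i + y j) ^ 2 else 0) = edgeForm G x := by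
    rw [hsum, edgeForm]
    refine Finset.sum_congr rfl fun u _ => ?_
    rw [hsum]
    refine Finset.sum_congr rfl fun v _ => ?_
    have hiff : (G.map f).Adj (e u) (e v) ↔ G.Adj u v := SimpleGraph.map_adj_apply (f := f)
    simp only [hiff, hye]
  have hyy : (fun i : Fin n => y i) ⬝ᵥ (fun i : Fin n => y i) = x ⬝ᵥ x := by
    simp only [dotProduct]
    rw [← Equiv.sum_comp e]
    simp only [hye]
  have hW := edgeForm_le (W n k s) fun i => y i
  rw [hyy] at hW
  have key' : edgeForm G x ≤ edgeForm (W n k s) fun i => y i := by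
    rw [← hL]
    convert key
  exact le_of_mul_le_mul_right (by linarith) hxx

end SpectralCycles

namespace SpectralCycles

/-! ### Short cycles and paths across a barrier -/

section Barrier

variable {V : Type*} [DecidableEq V] {G : SimpleGraph V} {X Z : Finset V} {u v : V} {S : Finset V}

/-- A path visits an independent set `Z` with neighbours in `X` at most once more than `X`. -/
theorem PathOn.card_inter_le (hXZ : Disjoint X Z) (hZ : ∀ z ∈ Z, ∀ w, G.Adj z w → w ∈ X)
    (h : PathOn G u v S) :
    (S ∩ Z).card ≤ (S ∩ X).card + 1 ∧ (u ∉ Z → (S ∩ Z).card ≤ (S ∩ X).card) := by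
  induction h with
  | single a =>
    by_cases ha : a ∈ Z
    · simp [ha, Finset.singleton_inter_of_mem]
    · simp [ha, Finset.singleton_inter_of_notMem]
  | @cons a b c S hab hp hn ih =>
    have hnZ : a ∉ S ∩ Z := fun h => hn (Finset.mem_inter.1 h).1
    have hnX : a ∉ S ∩ X := fun h => hn (Finset.mem_inter.1 h).1
    by_cases haZ : a ∈ Z
    · have hbX := hZ a haZ b hab
      have haX : a ∉ X := fun h => Finset.disjoint_left.1 hXZ h haZ
      have := ih.2 (Finset.disjoint_left.1 hXZ hbX)
      rw [Finset.insert_inter_of_mem haZ, Finset.insert_inter_of_notMem haX,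
        Finset.card_insert_of_notMem hnZ]
      exact ⟨by omega, fun h => absurd haZ h⟩
    · rw [Finset.insert_inter_of_notMem haZ]
      by_cases haX : a ∈ X
      · rw [Finset.insert_inter_of_mem haX, Finset.card_insert_of_notMem hnX]
        exact ⟨by omega, fun _ => by omega⟩
      · rw [Finset.insert_inter_of_notMem haX]
        have := ih.2 fun hb => haX (hZ b hb a hab.symm)
        exact ⟨by omega, fun _ => this⟩

/-- Since the last vertex is outside `Z`, each visit to `Z` is followed by its own vertex of `X`. If
the first vertex is outside `Z` too, the first visit is also preceded by a vertex of `X`, which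
gains one. -/
theorem PathOn.card_inter_lt (hXZ : Disjoint X Z) (hZ : ∀ z ∈ Z, ∀ w, G.Adj z w → w ∈ X)
    (h : PathOn G u v S) (hv : v ∉ Z) :
    (S ∩ Z).card ≤ (S ∩ X).card ∧
      (u ∉ Z → (S ∩ Z).card = 0 ∨ (S ∩ Z).card + 1 ≤ (S ∩ X).card) := by
  induction h with
  | single a => simp [hv, Finset.singleton_inter_of_notMem]
  | @cons a b c S hab hp hn ih =>
    have hnZ : a ∉ S ∩ Z := fun h => hn (Finset.mem_inter.1 h).1
    have hnX : a ∉ S ∩ X := fun h => hn (Finset.mem_inter.1 h).1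
    have ih := ih hv
    by_cases haZ : a ∈ Z
    · have hbX := hZ a haZ b hab
      have haX : a ∉ X := fun h => Finset.disjoint_left.1 hXZ h haZ
      have := ih.2 (Finset.disjoint_left.1 hXZ hbX)
      have hpos : 0 < (S ∩ X).card :=
        Finset.card_pos.2 ⟨b, Finset.mem_inter.2 ⟨hp.left_mem, hbX⟩⟩
      rw [Finset.insert_inter_of_mem haZ, Finset.insert_inter_of_notMem haX,
        Finset.card_insert_of_notMem hnZ]
      exact ⟨by omega, fun h => absurd haZ h⟩
    · rw [Finset.insert_inter_of_notMem haZ]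
      by_cases haX : a ∈ X
      · rw [Finset.insert_inter_of_mem haX, Finset.card_insert_of_notMem hnX]
        exact ⟨by omega, fun _ => by omega⟩
      · rw [Finset.insert_inter_of_notMem haX]
        have := ih.2 fun hb => haX (hZ b hb a hab.symm)
        exact ⟨by omega, fun _ => this⟩

/-- If `X` separates the independent set `Z` from the rest, cycles are short. -/
theorem not_hasCycleGE_of_barrier (hXZ : Disjoint X Z) (hZ : ∀ z ∈ Z, ∀ w, G.Adj z w → w ∈ X)
    {k s r : ℕ} (hs : X.card ≤ s) (hs0 : 0 < s) (hr : ∀ S : Finset V, Disjoint S Z → S.card ≤ r)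
    (hk : r + s ≤ k) (hsk : 2 * s < k) : ¬ HasCycleGE G k := by
  rintro ⟨v, c, hc, hkc⟩
  have hcyc := fun u (hu : u ∈ c.support.toFinset) => PathOn.of_isCycle hc (List.mem_toFinset.1 hu)
  have hcard : c.support.toFinset.card = c.length := by
    obtain ⟨-, -, -, h⟩ := hcyc v (by simp)
    exact h
  generalize c.support.toFinset = S at *
  have h1 := hr (S \ Z) Finset.sdiff_disjoint
  have h2 := (Finset.card_sdiff_add_card_inter S Z)
  have h3 := (Finset.card_le_card (Finset.inter_subset_right (s₁ := S) (s₂ := X))).trans hs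
  -- Opened at such a `y`, the cycle becomes a path with both ends outside `Z`. It therefore meets
  -- `Z` not at all or at most `s - 1` times. Without such a `y`, the cycle lies in `X ∪ Z` and has
  -- at most `2 * s` vertices.
  by_cases hy : ∃ y ∈ S, y ∉ X ∧ y ∉ Z
  · obtain ⟨y, hyS, hyX, hyZ⟩ := hy
    obtain ⟨w, hp, hyw, -⟩ := hcyc y hyS
    have := (hp.card_inter_lt hXZ hZ hyZ).2 fun hw => hyX (hZ w hw y hyw.symm)
    omega
  · push Not at hy
    have h4 : (S \ Z).card ≤ (S ∩ X).card := Finset.card_le_card fun x hx => by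
      rw [Finset.mem_sdiff] at hx
      exact Finset.mem_inter.2 ⟨hx.1, by_contra fun h => hx.2 (hy x hx.1 h)⟩
    by_cases hz : ∃ z ∈ S, z ∈ Z
    · obtain ⟨z, hzS, hzZ⟩ := hz
      obtain ⟨w, hp, hzw, -⟩ := hcyc z hzS
      have := (hp.symm.card_inter_lt hXZ hZ (Finset.disjoint_left.1 hXZ (hZ z hzZ w hzw))).1
      omega
    · push Not at hz
      have : S ∩ Z = ∅ := Finset.disjoint_iff_inter_eq_empty.1 (Finset.disjoint_left.2 hz)
      rw [this, Finset.card_empty] at h2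
      omega

/-- If `X` separates the independent set `Z` from the rest, paths are short. -/
theorem not_hasPathOfOrder_of_barrier (hXZ : Disjoint X Z)
    (hZ : ∀ z ∈ Z, ∀ w, G.Adj z w → w ∈ X) {k s r : ℕ} (hs : X.card ≤ s)
    (hr : ∀ S : Finset V, Disjoint S Z → S.card ≤ r) (hk : r + s < k) (hsk : 2 * s + 1 < k) :
    ¬ HasPathOfOrder G k := by
  rintro ⟨u, v, p, hp, hpk⟩
  have hS := PathOn.of_isPath hp
  rw [← hp.card_support_toFinset] at hpk
  generalize p.support.toFinset = S at *
  have h1 := hr (S \ Z) Finset.sdiff_disjoint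
  have h2 := (Finset.card_sdiff_add_card_inter S Z)
  have h3 := (Finset.card_le_card (Finset.inter_subset_right (s₁ := S) (s₂ := X))).trans hs
  -- Splitting at `y` gives two halves with an end outside `Z` and no common vertex in `X`, so `Z`
  -- is visited at most `s` times. Otherwise the path has at most `2 * s + 1` vertices.
  by_cases hy : ∃ y ∈ S, y ∉ X ∧ y ∉ Z
  · obtain ⟨y, hyS, hyX, hyZ⟩ := hy
    obtain ⟨S₁, S₂, hp1, hp2, hu, hi⟩ := hS.split hyS
    have h4 := (hp1.symm.card_inter_le hXZ hZ).2 hyZ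
    have h5 := (hp2.card_inter_le hXZ hZ).2 hyZ
    have h6 : (S ∩ Z).card ≤ (S₁ ∩ Z).card + (S₂ ∩ Z).card := by
      rw [← hu, Finset.union_inter_distrib_right]
      exact Finset.card_union_le _ _
    have h7 : (S ∩ X).card = (S₁ ∩ X).card + (S₂ ∩ X).card := by
      rw [← hu, Finset.union_inter_distrib_right]
      refine Finset.card_union_of_disjoint (Finset.disjoint_left.2 fun x hx hx' => ?_)
      rw [Finset.mem_inter] at hx hx'
      have : x ∈ S₁ ∩ S₂ := Finset.mem_inter.2 ⟨hx.1, hx'.1⟩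
      rw [hi, Finset.mem_singleton] at this
      exact hyX (this ▸ hx.2)
    omega
  · push Not at hy
    have h4 : (S \ Z).card ≤ (S ∩ X).card := Finset.card_le_card fun x hx => by
      rw [Finset.mem_sdiff] at hx
      exact Finset.mem_inter.2 ⟨hx.1, by_contra fun h => hx.2 (hy x hx.1 h)⟩
    have := (hS.card_inter_le hXZ hZ).1
    omega

end Barrier

/-! ### Connectivity and extremality of `W` -/

section ExtremalGraph

variable {n k s : ℕ}

theorem card_filter_val_lt_le (n m : ℕ) :
    (Finset.univ.filter fun i : Fin n => i.val < m).card ≤ m := by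
  rw [← Finset.card_map Fin.valEmbedding, ← Finset.card_range m]
  refine Finset.card_le_card fun i hi => ?_
  rw [Finset.card_range] at *
  obtain ⟨j, hj, rfl⟩ := Finset.mem_map.1 hi
  simpa using hj

theorem W_barrier (hsk : 2 * s ≤ k) :
    Disjoint (Finset.univ.filter fun i : Fin n => i.val < s)
      (Finset.univ.filter fun i : Fin n => k - s ≤ i.val) ∧
    (∀ z ∈ Finset.univ.filter fun i : Fin n => k - s ≤ i.val, ∀ w, (W n k s).Adj z w →
      w ∈ Finset.univ.filter fun i : Fin n => i.val < s) ∧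
    ∀ S : Finset (Fin n), Disjoint S (Finset.univ.filter fun i : Fin n => k - s ≤ i.val) →
      S.card ≤ k - s := by
  refine ⟨Finset.disjoint_left.2 fun i hi hi' => ?_, fun z hz w hzw => ?_, fun S hS => ?_⟩
  · simp only [Finset.mem_filter, Finset.mem_univ, true_and] at hi hi'
    omega
  · rw [W_adj_iff hsk] at hzw
    simp only [Finset.mem_filter, Finset.mem_univ, true_and] at hz ⊢
    omega
  · refine le_trans (Finset.card_le_card fun i hi => ?_) (card_filter_val_lt_le n (k - s))
    have := Finset.disjoint_left.1 hS hi
    simp only [Finset.mem_filter, Finset.mem_univ, true_and] at this ⊢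
    omega

theorem not_hasCycleGE_W (hs : 0 < s) (hsk : 2 * s < k) : ¬ HasCycleGE (W n k s) k := by
  obtain ⟨h1, h2, h3⟩ := W_barrier (n := n) hsk.le
  exact not_hasCycleGE_of_barrier h1 h2 (card_filter_val_lt_le n s) hs h3 (by omega) hsk

theorem not_hasPathOfOrder_W (hsk : 2 * s + 1 < k) : ¬ HasPathOfOrder (W n (k - 1) s) k := by
  obtain ⟨h1, h2, h3⟩ := W_barrier (n := n) (k := k - 1) (s := s) (by omega)
  exact not_hasPathOfOrder_of_barrier h1 h2 (card_filter_val_lt_le n s) h3 (by omega) hsk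

theorem connected_of_forall_adj {V : Type*} {G : SimpleGraph V} (v : V)
    (h : ∀ w, w ≠ v → G.Adj v w) : G.Connected := by
  refine (SimpleGraph.connected_iff_exists_forall_reachable G).2 ⟨v, fun w => ?_⟩
  by_cases hw : w = v
  · rw [hw]
  · exact (h w hw).reachable

theorem W_adj_of_lt (hsk : 2 * s ≤ k) {i : Fin n} (hi : i.val < s) (j : Fin n) (hj : j ≠ i) :
    (W n k s).Adj i j :=
  (W_adj_iff hsk i j).2 ⟨fun h => hj (Fin.ext h.symm), Or.inr (Or.inl hi)⟩

theorem connected_W (hs : 0 < s) (hsk : 2 * s ≤ k) (hn : 0 < n) : (W n k s).Connected :=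
  connected_of_forall_adj ⟨0, hn⟩ (W_adj_of_lt hsk hs)

theorem twoConnected_W (hs : 2 ≤ s) (hsk : 2 * s ≤ k) (hkn : k ≤ n) :
    TwoConnected (W n k s) := by
  refine ⟨by rw [Fintype.card_fin]; omega, connected_W (by omega) hsk (by omega), fun v => ?_⟩
  obtain ⟨i, hi, hiv⟩ : ∃ i : Fin n, i.val < s ∧ i ≠ v := by
    by_cases hv : v.val = 0
    · exact ⟨⟨1, by omega⟩, hs, fun h => by rw [← h] at hv; simp at hv⟩
    · exact ⟨⟨0, by omega⟩, by simp; omega, fun h => by rw [← h] at hv; simp at hv⟩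
  exact connected_of_forall_adj ⟨i, hiv⟩ fun w hw =>
    W_adj_of_lt hsk hi w fun h => hw (Subtype.ext h)

end ExtremalGraph

/-! ### The cone: from cycles to paths -/

section Cone

variable {V : Type*}

/-- The cone over `G`: one new vertex, joined to all others. -/
def cone (G : SimpleGraph V) : SimpleGraph (Option V) where
  Adj a b := a ≠ b ∧ ∀ x ∈ a, ∀ y ∈ b, G.Adj x y
  symm := ⟨fun _ _ h => ⟨h.1.symm, fun x hx y hy => (h.2 y hy x hx).symm⟩⟩
  loopless := ⟨fun _ h => h.1 rfl⟩

theorem cone_adj_none (G : SimpleGraph V) (v : V) : (cone G).Adj none (some v) :=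
  ⟨by simp, by simp⟩

theorem cone_adj_some {G : SimpleGraph V} {u v : V} :
    (cone G).Adj (some u) (some v) ↔ G.Adj u v := by
  simp only [cone, ne_eq, Option.some.injEq, Option.mem_def, forall_eq']
  exact ⟨fun h => h.2, fun h => ⟨h.ne, h⟩⟩

theorem twoConnected_cone [Fintype V] {G : SimpleGraph V} (hG : G.Connected)
    (hV : 2 ≤ Fintype.card V) : TwoConnected (cone G) := by
  have hnone : ∀ w, w ≠ none → (cone G).Adj none w := fun w hw => by
    obtain ⟨v, rfl⟩ := Option.ne_none_iff_exists'.1 hw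
    exact cone_adj_none G v
  refine ⟨by rw [Fintype.card_option]; omega, connected_of_forall_adj none hnone, fun v => ?_⟩
  cases v with
  | some v =>
    exact connected_of_forall_adj ⟨none, by simp⟩ fun w hw =>
      hnone w fun h => hw (Subtype.ext h)
  | none =>
    let f : G →g (cone G).induce {none}ᶜ :=
      ⟨fun v => ⟨some v, by simp⟩, fun h => cone_adj_some.2 h⟩
    obtain ⟨v₀⟩ := hG.nonempty
    refine (SimpleGraph.connected_iff_exists_forall_reachable _).2 ⟨f v₀, ?_⟩
    rintro ⟨w, hw⟩
    obtain ⟨w, rfl⟩ := Option.ne_none_iff_exists'.1 hw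
    exact (hG.preconnected v₀ w).map f

variable [DecidableEq V] {G : SimpleGraph V}

theorem PathOn.of_cone {u v : Option V} {S : Finset (Option V)} (h : PathOn (cone G) u v S)
    (hS : none ∉ S) : ∃ a b T, u = some a ∧ v = some b ∧ PathOn G a b T ∧ S = T.map .some := by
  induction h with
  | single v =>
    obtain ⟨a, rfl⟩ := Option.ne_none_iff_exists'.1 (show v ≠ none by rintro rfl; simp at hS)
    exact ⟨a, a, {a}, rfl, rfl, .single a, by simp⟩
  | @cons u v w S huv hp hn ih =>
    rw [Finset.mem_insert, not_or] at hS
    obtain ⟨a, b, T, rfl, rfl, hT, rfl⟩ := ih hS.2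
    obtain ⟨c, rfl⟩ := Option.ne_none_iff_exists'.1 (Ne.symm hS.1)
    exact ⟨c, b, insert c T, rfl, rfl, .cons (cone_adj_some.1 huv) hT (by simpa using hn),
      by rw [Finset.map_insert]; rfl⟩

theorem PathOn.hasPathOfOrder {u v : V} {S : Finset V} (h : PathOn G u v S) {k : ℕ} (hk : 0 < k)
    (hkS : k ≤ S.card) : HasPathOfOrder G k := by
  obtain ⟨p, hp, rfl⟩ := h.exists_isPath
  rw [hp.card_support_toFinset] at hkS
  refine ⟨_, _, p.take (k - 1), hp.take _, ?_⟩
  rw [SimpleGraph.Walk.take_length]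
  omega

/-- If the cycle passes through the apex, deleting the apex leaves a path of `G`. Otherwise the
cycle is opened anywhere. At least `k` vertices remain in both cases. -/
theorem hasPathOfOrder_of_cone {k : ℕ} (hk : 0 < k) (h : HasCycleGE (cone G) (k + 1)) :
    HasPathOfOrder G k := by
  obtain ⟨v, c, hc, hkc⟩ := h
  have hcyc := fun u (hu : u ∈ c.support.toFinset) => PathOn.of_isCycle hc (List.mem_toFinset.1 hu)
  obtain ⟨w, hp, -, hcard⟩ := hcyc v (by simp)
  generalize c.support.toFinset = S at *
  by_cases hS : none ∈ S
  · obtain ⟨w, hp, -, -⟩ := hcyc none hS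
    cases hp.symm with
    | single => simp at hcard; omega
    | @cons _ b _ S' _ hp' hn =>
      rw [Finset.card_insert_of_notMem hn] at hcard
      obtain ⟨a, b, T, -, -, hT, rfl⟩ := hp'.of_cone hn
      rw [Finset.card_map] at hcard
      exact hT.hasPathOfOrder hk (by omega)
  · obtain ⟨a, b, T, -, -, hT, rfl⟩ := hp.of_cone hS
    rw [Finset.card_map] at hcard
    exact hT.hasPathOfOrder hk (by omega)

/-- The apex adds one to the size of a set and one to each degree. If the apex itself is the vertex
of small degree, then `|B| ≤ s + 1` and every vertex of `B` has degree at most `s` in `B`. -/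
theorem CoreLE.of_cone {s m : ℕ} (h : CoreLE (cone G) (s + 1) (m + 1)) : CoreLE G s m := by
  classical
  intro B hB
  have hBsub : ∀ b ∈ B, degIn G B b + 1 ≤ B.card := fun b hb => by
    rw [← Finset.card_erase_add_one hb]
    refine Nat.add_le_add_right (Finset.card_le_card fun x hx => ?_) 1
    rw [Finset.mem_filter] at hx
    exact Finset.mem_erase.2 ⟨hx.2.ne.symm, hx.1⟩
  obtain ⟨v, hv, hd⟩ := h (Finset.insertNone B) (by rw [Finset.card_insertNone]; omega)
  cases v with
  | none =>
    obtain ⟨b, hb⟩ := Finset.card_pos.1 (by omega : 0 < B.card)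
    refine ⟨b, hb, ?_⟩
    have : B.card ≤ degIn (cone G) (Finset.insertNone B) none := by
      rw [← Finset.card_map .some]
      refine Finset.card_le_card fun x hx => ?_
      obtain ⟨y, hy, rfl⟩ := Finset.mem_map.1 hx
      exact Finset.mem_filter.2 ⟨by simpa using hy, cone_adj_none G y⟩
    have := hBsub b hb
    omega
  | some b =>
    refine ⟨b, by simpa using hv, ?_⟩
    have : degIn G B b + 1 ≤ degIn (cone G) (Finset.insertNone B) (some b) := by
      rw [degIn, degIn, ← Finset.card_insertNone]
      refine Finset.card_le_card fun x hx => ?_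
      cases x with
      | none => exact Finset.mem_filter.2 ⟨by simp, (cone_adj_none G b).symm⟩
      | some x =>
        simp only [Finset.some_mem_insertNone, Finset.mem_filter] at hx ⊢
        exact ⟨hx.1, cone_adj_some.2 hx.2⟩
    omega

end Cone

/-! ### Assembling the bounds and the theorem -/

theorem exists_q_le_of_not_hasCycleGE {V : Type*} [Fintype V] {G : SimpleGraph V} {n k : ℕ}
    (hV : Fintype.card V = n) (hG : TwoConnected G) (hk : 5 ≤ k) (hkn : k ≤ n)
    (hfree : ¬ HasCycleGE G k) : ∃ s ∈ Finset.Icc 2 ((k - 1) / 2), q G ≤ q (W n k s) := by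
  obtain ⟨s, h1, h2, h3⟩ := exists_coreLE hG hk (hV ▸ hkn) hfree
  exact ⟨s, Finset.mem_Icc.2 ⟨h1, h2⟩, q_le_of_coreLE hV (by omega) (by omega) hkn h3⟩

theorem exists_q_le_of_not_hasPathOfOrder {V : Type*} [Fintype V] {G : SimpleGraph V} {n k : ℕ}
    (hV : Fintype.card V = n) (hG : G.Connected) (hk : 4 ≤ k) (hkn : k ≤ n)
    (hfree : ¬ HasPathOfOrder G k) :
    ∃ s ∈ Finset.Icc 1 (k / 2 - 1), q G ≤ q (W n (k - 1) s) := by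
  classical
  obtain ⟨s, h1, h2, h3⟩ := exists_coreLE (k := k + 1) (twoConnected_cone hG (by omega)) (by omega)
    (by rw [Fintype.card_option]; omega) fun h => hfree (hasPathOfOrder_of_cone (by omega) h)
  -- The cone is treated with `k + 1`, so `2 ≤ s ≤ k / 2`. Removing the apex turns `s` into `s - 1`
  -- and the core bound `k + 1 - s` into `(k - 1) - (s - 1)`.
  refine ⟨s - 1, Finset.mem_Icc.2 (by omega), q_le_of_coreLE hV (by omega) (by omega) (by omega) ?_⟩
  refine CoreLE.of_cone ?_
  rwa [show s - 1 + 1 = s by omega, show k - 1 - (s - 1) + 1 = k + 1 - s by omega]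

end SpectralCycles

theorem theorem4p13 (n k t : ℕ) :
    (∀ (_ : 5 ≤ k) (_ : k ≤ n) (_ : t = (k - 1) / 2),
      (∀ (V : Type*) [Fintype V] (G : SimpleGraph V), Fintype.card V = n →
        SpectralCycles.TwoConnected G →
        (Finset.Icc 2 t).sup' (Finset.nonempty_Icc.mpr (by omega))
          (fun s => SpectralCycles.q (SpectralCycles.W n k s)) < SpectralCycles.q G →
        SpectralCycles.HasCycleGE G k) ∧
      IsGreatest
        {x : ℝ | ∃ G : SimpleGraph (Fin n), SpectralCycles.TwoConnected G ∧
          ¬ SpectralCycles.HasCycleGE G k ∧ SpectralCycles.q G = x}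
        ((Finset.Icc 2 t).sup' (Finset.nonempty_Icc.mpr (by omega))
          (fun s => SpectralCycles.q (SpectralCycles.W n k s)))) ∧
    (∀ (_ : 4 ≤ k) (_ : k ≤ n) (_ : t = k / 2 - 1),
      (∀ (V : Type*) [Fintype V] (G : SimpleGraph V), Fintype.card V = n →
        G.Connected →
        (Finset.Icc 1 t).sup' (Finset.nonempty_Icc.mpr (by omega))
          (fun s => SpectralCycles.q (SpectralCycles.W n (k - 1) s)) < SpectralCycles.q G →
        SpectralCycles.HasPathOfOrder G k) ∧
      IsGreatest
        {x : ℝ | ∃ G : SimpleGraph (Fin n), G.Connected ∧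
          ¬ SpectralCycles.HasPathOfOrder G k ∧ SpectralCycles.q G = x}
        ((Finset.Icc 1 t).sup' (Finset.nonempty_Icc.mpr (by omega))
          (fun s => SpectralCycles.q (SpectralCycles.W n (k - 1) s)))) := by
  open SpectralCycles in
  constructor
  · rintro hk hkn rfl
    refine ⟨fun V _ G hV hG hq => by_contra fun hfree => hq.not_ge ?_, ?_, ?_⟩
    · obtain ⟨s, hs, hle⟩ := exists_q_le_of_not_hasCycleGE hV hG hk hkn hfree
      exact hle.trans (Finset.le_sup' (fun s => q (W n k s)) hs)
    · obtain ⟨s, hs, he⟩ := Finset.exists_mem_eq_sup' (s := Finset.Icc 2 ((k - 1) / 2))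
        (Finset.nonempty_Icc.mpr (by omega)) (fun s => q (W n k s))
      rw [Finset.mem_Icc] at hs
      exact ⟨W n k s, twoConnected_W hs.1 (by omega) hkn,
        not_hasCycleGE_W (by omega) (by omega), he.symm⟩
    · rintro _ ⟨G, hG, hfree, rfl⟩
      obtain ⟨s, hs, hle⟩ := exists_q_le_of_not_hasCycleGE (Fintype.card_fin n) hG hk hkn hfree
      exact hle.trans (Finset.le_sup' (fun s => q (W n k s)) hs)
  · rintro hk hkn rfl
    refine ⟨fun V _ G hV hG hq => by_contra fun hfree => hq.not_ge ?_, ?_, ?_⟩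
    · obtain ⟨s, hs, hle⟩ := exists_q_le_of_not_hasPathOfOrder hV hG hk hkn hfree
      exact hle.trans (Finset.le_sup' (fun s => q (W n (k - 1) s)) hs)
    · obtain ⟨s, hs, he⟩ := Finset.exists_mem_eq_sup' (s := Finset.Icc 1 (k / 2 - 1))
        (Finset.nonempty_Icc.mpr (by omega)) (fun s => q (W n (k - 1) s))
      rw [Finset.mem_Icc] at hs
      exact ⟨W n (k - 1) s, connected_W (by omega) (by omega) (by omega),
        not_hasPathOfOrder_W (by omega), he.symm⟩
    · rintro _ ⟨G, hG, hfree, rfl⟩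
      obtain ⟨s, hs, hle⟩ := exists_q_le_of_not_hasPathOfOrder (Fintype.card_fin n) hG hk hkn hfree
      exact hle.trans (Finset.le_sup' (fun s => q (W n (k - 1) s)) hs)
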